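/- Let $p,q$ be complex-valued functions of bounded variation on $[0,\pi]$, $Q(x)=\begin{pmatrix}p(x)&q(x)\\ q(x)&-p(x)\end{pmatrix}$, and for $t\in\mathbb C$ let $L_t(Q)$ be the operator generated in $L_2([0,\pi];\mathbb C^2)$ by $$\begin{pmatrix}0&1\\-1&0\end{pmatrix}\mathbf y'(x)+Q(x)\mathbf y(x),\qquad \mathbf y(\pi)=e^{i\pi t}\mathbf y(0).$$ Let $\mathbf c(x,\lambda)=(c_1,c_2)^T$ and $\mathbf s(x,\lambda)=(s_1,s_2)^T$ be the solutions of $\begin{pmatrix}0&1\\-1&0\end{pmatrix}\mathbf y'+Q\mathbf y=\lambda\mathbf y$ with $\mathbf c(0,\lambda)=(1,0)^T$, $\mathbf s(0,\lambda)=(0,1)^T$, and put $F(\lambda)=c_1(\pi,\lambda)+s_2(\pi,\lambda)$. Fix $h\in(0,1/10)$ and let $$D_h(0,1)=\{t\in\mathbb C:|\operatorname{Im}t|\le 2h,\ -h\le\operatorname{Re}t\le 2-h\}\setminus\big(\{|t|<h\}\cup\{|t-1|<h\}\big).$$ Let $\lambda_{n,1}(t)$ and $\lambda_{n,2}(t)$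 ($n\in\mathbb Z$, $|n|$ large, $t\in D_h(0,1)$) be eigenvalues of $L_t(Q)$ with $$\lambda_{n,1}(t)=2n+t+O(1/n),\qquad \lambda_{n,2}(t)=2n-t+O(1/n)\qquad(|n|\to\infty)$$ uniformly in $t\in D_h(0,1)$; such eigenvalues exist. For $j=1,2$ put $$\Phi_{n,j,t}(x)=s_1(\pi,\lambda)\,\mathbf c(x,\lambda)+\big(e^{i\pi t}-c_1(\pi,\lambda)\big)\,\mathbf s(x,\lambda),\qquad \lambda=\lambda_{n,j}(t).$$ Then, for all sufficiently large $|n|$ and all $t\in D_h(0,1)$, $F'(\lambda_{n,j}(t))\ne0$, $s_1(\pi,\lambda_{n,j}(t))\neq 0$ and $\Phi_{n,j,t}$ is an eigenfunction of $L_t(Q)$ for the eigenvalue $\lambda_{n,j}(t)$; and, normalized by the factor $1/s_1(\pi,\lambda_{n,j}(t))$, these eigenfunctions satisfy $$\frac{\Phi_{n,1,t}(x)}{s_1(\pi,\lambda_{n,1}(t))}=\begin{pmatrix}1\\-i\end{pmatrix}e^{i(2n+t)x}+O\Big(\frac1n\Big),\qquad \frac{\Phi_{n,2,t}(x)}{s_1(\pi,\lambda_{n,2}(t))}=\begin{pmatrix}1\\i\end{pmatrix}e^{i(-2n+t)x}+O\Big(\frac1n\Big)$$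 as $|n|\to\infty$, uniformly in $t\in D_h(0,1)$ and $x\in[0,\pi]$. -/

import Mathlib

open MeasureTheory Set
open scoped Real Matrix

noncomputable section

namespace Dirac

/-- The constant matrix in front of the derivative in the Dirac expression. -/
def J : Matrix (Fin 2) (Fin 2) ℂ := !![0, 1; -1, 0]

/-- The potential matrix `Q(x)`. -/
def Q (p q : ℝ → ℂ) (x : ℝ) : Matrix (Fin 2) (Fin 2) ℂ := !![p x, q x; q x, -p x]

/-- `y` is a solution of `J y' + Q y = lam y` on `[0, π]`: it is absolutely continuous there and
satisfies the equation almost everywhere. -/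
def IsSolution (p q : ℝ → ℂ) (lam : ℂ) (y : ℝ → Fin 2 → ℂ) : Prop :=
  AbsolutelyContinuousOnInterval y 0 π ∧
    ∀ᵐ x ∂(volume.restrict (Icc 0 π)),
      DifferentiableAt ℝ y x ∧ J *ᵥ deriv y x + Q p q x *ᵥ y x = lam • y x

/-- The solution of `J y' + Q y = lam y` on `[0, π]` with initial value `y 0 = v`. Its values on
`[0, π]` are uniquely determined; the values elsewhere are irrelevant. -/
def solution (p q : ℝ → ℂ) (lam : ℂ) (v : Fin 2 → ℂ) : ℝ → Fin 2 → ℂ :=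
  Classical.epsilon fun y => IsSolution p q lam y ∧ y 0 = v

/-- The fundamental solution `c(x, lam)` with `c(0, lam) = (1, 0)`. -/
def c (p q : ℝ → ℂ) (lam : ℂ) : ℝ → Fin 2 → ℂ := solution p q lam ![1, 0]

/-- The fundamental solution `s(x, lam)` with `s(0, lam) = (0, 1)`. -/
def s (p q : ℝ → ℂ) (lam : ℂ) : ℝ → Fin 2 → ℂ := solution p q lam ![0, 1]

/-- `F(lam) = c₁(π, lam) + s₂(π, lam)`. -/
def F (p q : ℝ → ℂ) (lam : ℂ) : ℂ := c p q lam π 0 + s p q lam π 1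

/-- `y` is an eigenfunction, with eigenvalue `lam`, of the operator `L_t(Q)` generated in
`L²([0, π]; ℂ²)` by `J y' + Q y` and the boundary condition `y(π) = exp (i π t) y(0)`.
(As `Q` is bounded, `J y' + Q y = lam y` makes `y'` square integrable.) -/
def IsEigenfunction (p q : ℝ → ℂ) (t lam : ℂ) (y : ℝ → Fin 2 → ℂ) : Prop :=
  IsSolution p q lam y ∧ y π = Complex.exp (Complex.I * π * t) • y 0 ∧ ∃ x ∈ Icc 0 π, y x ≠ 0

/-- `lam` is an eigenvalue of `L_t(Q)`. -/
def IsEigenvalue (p q : ℝ → ℂ) (t lam : ℂ) : Prop := ∃ y, IsEigenfunction p q t lam y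

/-- `Φ_t(x) = s₁(π, lam) c(x, lam) + (exp (i π t) - c₁(π, lam)) s(x, lam)`. -/
def Phi (p q : ℝ → ℂ) (t lam : ℂ) (x : ℝ) : Fin 2 → ℂ :=
  s p q lam π 0 • c p q lam x
    + (Complex.exp (Complex.I * π * t) - c p q lam π 0) • s p q lam x

/-- The set `D_h(0,1)`: the rectangle `|Im t| ≤ 2h`, `-h ≤ Re t ≤ 2 - h` without the open discs of
radius `h` around `0` and `1`. -/
def D (h : ℝ) : Set ℂ :=
  {t : ℂ | |t.im| ≤ 2 * h ∧ -h ≤ t.re ∧ t.re ≤ 2 - h} \ (Metric.ball 0 h ∪ Metric.ball 1 h)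

/-- `lam n t`, for `|n|` large and `t ∈ D_h(0,1)`, is an eigenvalue of `L_t(Q)`, and
`lam n t = 2n + σt + O(1/n)` uniformly in `t`. The sequences `λ_{n,1}` and `λ_{n,2}` are
those with `σ = 1` and `σ = -1`. -/
def IsEigenvalueSequence (p q : ℝ → ℂ) (h : ℝ) (σ : ℂ) (lam : ℤ → ℂ → ℂ) : Prop :=
  ∃ N : ℕ, ∃ C : ℝ, ∀ n : ℤ, (N : ℤ) < |n| → ∀ t ∈ D h,
    IsEigenvalue p q t (lam n t) ∧ ‖lam n t - (2 * n + σ * t)‖ ≤ C / |(n : ℝ)|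

end Dirac

end

/-!
The amplitudes `exp (∓ i lam x) (y₁ ± i y₂)` of a solution `y` are constant for `p = q = 0`, and in
general they solve a coupled system `U' = α V`, `V' = β U` whose coefficients are functions of
bounded variation times `exp (∓ 2 i lam x)`. Integration by parts against such a function gains a
factor `1 / |lam|` in a horizontal strip, so `y` is `O(1 / |lam|)`-close to a rotating vector. Hence
`F(lam) = 2 cos (π lam) + O(1 / |lam|)`, and Cauchy's estimate gives the corresponding statement
for `F'`. Away from the integers `t`, where `sin (π t)` is bounded below, `F'` is bounded below
near `2n ± t`, so that `F = 2 cos (π t)`, the equation for the eigenvalues of `L_t(Q)`, has a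
root there. The initial value of `Φ / s₁(π)` is `O(1 / n)`-close to `(1, ∓ i)`, an eigenvector of
all rotations, and the eigenfunction inherits this approximation on all of `[0, π]`.
-/

section

open Filter Topology

section AbsolutelyContinuous

variable {E F : Type*}

theorem absolutelyContinuousOnInterval_of_dist_le [PseudoMetricSpace E] [PseudoMetricSpace F]
    {f : ℝ → E} {φ : ℝ → F} {a b : ℝ} (K : ℝ) (hφ : AbsolutelyContinuousOnInterval φ a b)
    (h : ∀ x ∈ uIcc a b, ∀ y ∈ uIcc a b, dist (f x) (f y) ≤ K * dist (φ x) (φ y)) :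
    AbsolutelyContinuousOnInterval f a b := by
  have hK : Tendsto (fun I : ℕ × (ℕ → ℝ × ℝ) =>
      K * ∑ i ∈ Finset.range I.1, dist (φ (I.2 i).1) (φ (I.2 i).2))
      (AbsolutelyContinuousOnInterval.totalLengthFilter ⊓
        𝓟 (AbsolutelyContinuousOnInterval.disjWithin a b)) (𝓝 0) := by
    simpa only [mul_zero] using Tendsto.const_mul K hφ
  refine squeeze_zero' (.of_forall fun I => Finset.sum_nonneg fun _ _ => dist_nonneg) ?_ hK
  filter_upwards [mem_inf_of_right (mem_principal_self _)] with I hI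
  rw [Finset.mul_sum]
  exact Finset.sum_le_sum fun i hi => h _ (hI.1 i hi).1 _ (hI.1 i hi).2

theorem absolutelyContinuousOnInterval_apply {ι : Type*} [Fintype ι] {G : ι → Type*}
    [∀ i, PseudoMetricSpace (G i)] {f : ℝ → ∀ i, G i} {a b : ℝ}
    (hf : AbsolutelyContinuousOnInterval f a b) (i : ι) :
    AbsolutelyContinuousOnInterval (fun x => f x i) a b :=
  absolutelyContinuousOnInterval_of_dist_le 1 hf fun x _ y _ => by
    simpa only [one_mul] using dist_le_pi_dist (f x) (f y) i

theorem absolutelyContinuousOnInterval_const [PseudoMetricSpace E] (z : E) (a b : ℝ) :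
    AbsolutelyContinuousOnInterval (fun _ => z) a b :=
  (LipschitzWith.const z).lipschitzOnWith.absolutelyContinuousOnInterval

variable [NormedAddCommGroup E] [NormedSpace ℝ E] {f g : ℝ → E} {a b x : ℝ}

theorem absolutelyContinuousOnInterval_primitive (hg : IntervalIntegrable g volume a b) :
    AbsolutelyContinuousOnInterval (fun x => ∫ u in a..x, g u) a b := by
  refine absolutelyContinuousOnInterval_of_dist_le 1
    (hg.norm.absolutelyContinuousOnInterval_intervalIntegral left_mem_uIcc) fun x hx y hy => ?_
  have hi : ∀ z ∈ uIcc a b, IntervalIntegrable g volume a z := fun z hz =>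
    hg.mono_set (uIcc_subset_uIcc_left hz)
  rw [one_mul, dist_eq_norm, dist_eq_norm,
    intervalIntegral.integral_interval_sub_left (hi x hx) (hi y hy),
    intervalIntegral.integral_interval_sub_left (hi x hx).norm (hi y hy).norm]
  exact intervalIntegral.norm_integral_le_abs_integral_norm

variable [CompleteSpace E]

theorem sub_eq_integral_of_ae_hasDerivAt (hf : AbsolutelyContinuousOnInterval f a b)
    (hg : IntervalIntegrable g volume a b) (hfg : ∀ᵐ u, u ∈ uIcc a b → HasDerivAt f (g u) u)
    (hx : x ∈ uIcc a b) : f x - f a = ∫ u in a..x, g u := by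
  have hd : ∀ᵐ u, u ∈ uIcc a b →
      HasDerivAt (f - fun u => ∫ v in a..u, g v) 0 u := by
    filter_upwards [hfg, hg.ae_hasDerivAt_integral] with u hu hu' hm
    simpa only [sub_self] using (hu hm).sub (hu' hm a left_mem_uIcc)
  obtain ⟨C, hC⟩ :=
    (hf.sub (absolutelyContinuousOnInterval_primitive hg)).const_of_ae_hasDerivAt_zero hd
  have hxa := (hC x hx).trans (hC a left_mem_uIcc).symm
  simp only [Pi.sub_apply, intervalIntegral.integral_same, sub_zero] at hxa
  rw [← hxa, sub_sub_cancel]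

end AbsolutelyContinuous

section BoundedVariation

theorem exists_norm_le_of_boundedVariationOn {α E : Type*} [LinearOrder α]
    [SeminormedAddCommGroup E] {f : α → E} {s : Set α} (hf : BoundedVariationOn f s) :
    ∃ M, 0 ≤ M ∧ ∀ x ∈ s, ‖f x‖ ≤ M := by
  rcases s.eq_empty_or_nonempty with rfl | ⟨y, hy⟩
  · exact ⟨0, le_rfl, by simp⟩
  refine ⟨(eVariationOn f s).toReal + ‖f y‖, by positivity, fun x hx => ?_⟩
  have hd := hf.dist_le hx hy
  rw [dist_eq_norm] at hd
  linarith [norm_sub_norm_le (f x) (f y)]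

theorem dist_le_variationOnFromTo_sub {α E : Type*} [LinearOrder α] [PseudoMetricSpace E]
    {f : α → E} {s : Set α} (hf : LocallyBoundedVariationOn f s) {a x y : α} (ha : a ∈ s)
    (hx : x ∈ s) (hy : y ∈ s) (hxy : x ≤ y) :
    dist (f x) (f y) ≤ variationOnFromTo f s a y - variationOnFromTo f s a x := by
  rw [variationOnFromTo.sub_right hf ha hy hx, variationOnFromTo.eq_of_le f s hxy, dist_edist]
  exact ENNReal.toReal_mono (hf _ _ hx hy)
    (eVariationOn.edist_le f (s := s ∩ Icc x y) ⟨hx, le_rfl, hxy⟩ ⟨hy, hxy, le_rfl⟩)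

theorem norm_sub_le_variationOnFromTo_sub {α E : Type*} [LinearOrder α]
    [SeminormedAddCommGroup E] {f : α → E} {s : Set α}
    (hf : LocallyBoundedVariationOn f s) {a x y u v : α} (ha : a ∈ s)
    (hx : x ∈ s) (hy : y ∈ s) (hu : u ∈ s) (hv : v ∈ s) (hxu : x ≤ u) (huv : u ≤ v)
    (hvy : v ≤ y) :
    ‖f u - f v‖ ≤ variationOnFromTo f s a y - variationOnFromTo f s a x := by
  have hd := dist_le_variationOnFromTo_sub hf ha hu hv huv
  rw [dist_eq_norm] at hd
  linarith [variationOnFromTo.monotoneOn hf ha hx hu hxu,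
    variationOnFromTo.monotoneOn hf ha hv hy hvy]

variable {𝕜 : Type*} [RCLike 𝕜] {f g : ℝ → 𝕜} {a b B ε : ℝ}

theorem intervalIntegrable_of_boundedVariationOn (hf : BoundedVariationOn f (uIcc a b)) :
    IntervalIntegrable f volume a b := by
  have real : ∀ u : ℝ → ℝ, BoundedVariationOn u (uIcc a b) →
      IntervalIntegrable u volume a b := fun u hu => by
    obtain ⟨v, w, hv, hw, rfl⟩ := hu.locallyBoundedVariationOn.exists_monotoneOn_sub_monotoneOn
    exact hv.intervalIntegrable.sub hw.intervalIntegrable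
  have hre := real _ ((RCLike.reCLM (K := 𝕜)).lipschitz.comp_boundedVariationOn hf)
  have him := real _ ((RCLike.imCLM (K := 𝕜)).lipschitz.comp_boundedVariationOn hf)
  rw [intervalIntegrable_iff] at hre him ⊢
  exact Integrable.re_im_iff.1 ⟨hre, him⟩

theorem norm_sub_le_mul_of_forall_norm_sub_le {E : Type*} [SeminormedAddCommGroup E] {φ : ℝ → E}
    {V : ℝ → ℝ} (hab : a ≤ b) (h : ∀ x ∈ Icc a b, ∀ y ∈ Icc a b, x ≤ y →
      ‖φ y - φ x‖ ≤ (V y - V x) * (ε + B * (y - x))) :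
    ‖φ b - φ a‖ ≤ (V b - V a) * ε := by
  -- Over the pieces of the subdivision into `n + 1` equal parts the bounds telescope.
  have hsubdivision : ∀ n : ℕ, ‖φ b - φ a‖ ≤ (V b - V a) * (ε + B * ((b - a) / (n + 1))) := by
    intro n
    set d : ℝ := (b - a) / (n + 1) with hd
    have hd0 : 0 ≤ d := div_nonneg (sub_nonneg.2 hab) (by positivity)
    have hdn : a + ((n + 1 : ℕ) : ℝ) * d = b := by push_cast; rw [hd]; field_simp; ring
    have hmem : ∀ k : ℕ, k ≤ n + 1 → a + k * d ∈ Icc a b := fun k hk => by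
      have hkd : (k : ℝ) * d ≤ (n + 1 : ℕ) * d := by gcongr
      exact ⟨by linarith [mul_nonneg k.cast_nonneg hd0], by linarith⟩
    have hstep : ∀ k ∈ Finset.range (n + 1), ‖φ (a + (k + 1 : ℕ) * d) - φ (a + k * d)‖
        ≤ (V (a + (k + 1 : ℕ) * d) - V (a + k * d)) * (ε + B * d) := fun k hk => by
      have hk : k + 1 ≤ n + 1 := Finset.mem_range.1 hk
      have hkd : a + ((k + 1 : ℕ) : ℝ) * d - (a + k * d) = d := by push_cast; ring
      have := h _ (hmem k (by omega)) _ (hmem (k + 1) hk) (by linarith)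
      rwa [hkd] at this
    have hsum := norm_sum_le_of_le _ hstep
    rw [← Finset.sum_mul, Finset.sum_range_sub fun k : ℕ => φ (a + k * d),
      Finset.sum_range_sub fun k : ℕ => V (a + k * d), hdn] at hsum
    simpa only [Nat.cast_zero, zero_mul, add_zero] using hsum
  have hlim : Tendsto (fun n : ℕ => (V b - V a) * (ε + B * ((b - a) / ((n : ℝ) + 1)))) atTop
      (𝓝 ((V b - V a) * (ε + B * 0))) :=
    ((((tendsto_const_div_atTop_nhds_zero_nat (b - a)).comp (tendsto_add_atTop_nat 1)).congr
      fun n => by simp).const_mul B |>.const_add ε).const_mul _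
  simpa only [mul_zero, add_zero] using ge_of_tendsto' hlim hsubdivision

theorem norm_integral_sub_mul_le_of_boundedVariationOn (hf : BoundedVariationOn f (Icc a b))
    (hB : ∀ u ∈ Icc a b, ‖g u‖ ≤ B) {x y : ℝ} (hx : x ∈ Icc a b) (hy : y ∈ Icc a b) (hxy : x ≤ y) :
    ‖∫ u in x..y, (f u - f y) * g u‖
      ≤ (variationOnFromTo f (Icc a b) a y - variationOnFromTo f (Icc a b) a x) * B * (y - x) := by
  have ha : a ∈ Icc a b := left_mem_Icc.2 (hx.1.trans hx.2)
  refine (intervalIntegral.norm_integral_le_of_norm_le_const fun u hu => ?_).trans_eq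
    (by rw [abs_of_nonneg (sub_nonneg.2 hxy)])
  rw [uIoc_of_le hxy] at hu
  have hu' : u ∈ Icc a b := ⟨hx.1.trans hu.1.le, hu.2.trans hy.2⟩
  have hfu := norm_sub_le_variationOnFromTo_sub hf.locallyBoundedVariationOn ha hx hy hu' hy
    hu.1.le hu.2 le_rfl
  rw [norm_mul]
  exact mul_le_mul hfu (hB u hu') (norm_nonneg _) ((norm_nonneg _).trans hfu)

theorem integral_mul_sub_mul_integral_sub {x y : ℝ}
    (hfgx : IntervalIntegrable (fun u => f u * g u) volume a x)
    (hfgy : IntervalIntegrable (fun u => f u * g u) volume x y)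
    (hgx : IntervalIntegrable g volume a x) (hgy : IntervalIntegrable g volume x y) :
    ((∫ u in a..y, f u * g u) - f y * ∫ u in a..y, g u)
        - ((∫ u in a..x, f u * g u) - f x * ∫ u in a..x, g u)
      = (∫ u in x..y, (f u - f y) * g u) + (f x - f y) * ∫ u in a..x, g u := by
  simp only [sub_mul]
  rw [intervalIntegral.integral_sub hfgy (hgy.const_mul _), intervalIntegral.integral_const_mul,
    ← intervalIntegral.integral_add_adjacent_intervals hfgx hfgy,
    ← intervalIntegral.integral_add_adjacent_intervals hgx hgy]
  ring

theorem norm_integral_mul_le_of_boundedVariationOn (hab : a ≤ b)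
    (hf : BoundedVariationOn f (Icc a b)) (hg : ContinuousOn g (Icc a b))
    (hε : ∀ x ∈ Icc a b, ‖∫ u in a..x, g u‖ ≤ ε) :
    ‖∫ u in a..b, f u * g u‖ ≤ (‖f b‖ + (eVariationOn f (Icc a b)).toReal) * ε := by
  have ha : a ∈ Icc a b := left_mem_Icc.2 hab
  have hb : b ∈ Icc a b := right_mem_Icc.2 hab
  have hl := hf.locallyBoundedVariationOn
  obtain ⟨B, hB⟩ := isCompact_Icc.exists_bound_of_continuousOn hg
  rw [← uIcc_of_le hab] at hg
  have hfi : IntervalIntegrable f volume a b :=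
    intervalIntegrable_of_boundedVariationOn (by rwa [uIcc_of_le hab])
  have hfgi : IntervalIntegrable (fun u => f u * g u) volume a b := hfi.mul_continuousOn hg
  set V := variationOnFromTo f (Icc a b) a
  -- `Φ` is minus the Stieltjes integral of `∫ u in a..x, g u` against `f`.
  set Φ : ℝ → 𝕜 := fun x => (∫ u in a..x, f u * g u) - f x * ∫ u in a..x, g u with hΦ
  have hstep : ∀ x ∈ Icc a b, ∀ y ∈ Icc a b, x ≤ y →
      ‖Φ y - Φ x‖ ≤ (V y - V x) * (ε + B * (y - x)) := by
    intro x hx y hy hxy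
    have hax : uIcc a x ⊆ uIcc a b := uIcc_subset_uIcc_left (by rwa [uIcc_of_le hab])
    have hxy' : uIcc x y ⊆ uIcc a b := by rw [uIcc_of_le hab]; exact uIcc_subset_Icc hx hy
    have hsplit : Φ y - Φ x
        = (∫ u in x..y, (f u - f y) * g u) + (f x - f y) * ∫ u in a..x, g u :=
      integral_mul_sub_mul_integral_sub (hfgi.mono_set hax) (hfgi.mono_set hxy')
        (hg.intervalIntegrable.mono_set hax) (hg.intervalIntegrable.mono_set hxy')
    have hint := norm_integral_sub_mul_le_of_boundedVariationOn hf hB hx hy hxy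
    have hfxy := norm_sub_le_variationOnFromTo_sub hl ha hx hy hx hy le_rfl hxy le_rfl
    have hmul := mul_le_mul hfxy (hε x hx) (norm_nonneg _) ((norm_nonneg _).trans hfxy)
    rw [hsplit]
    refine (norm_add_le _ _).trans ?_
    rw [norm_mul]
    linarith
  have hVΦ := norm_sub_le_mul_of_forall_norm_sub_le hab hstep
  have hVb : V b - V a = (eVariationOn f (Icc a b)).toReal := by
    simp only [V, variationOnFromTo.self, sub_zero, variationOnFromTo.eq_of_le _ _ hab, inter_self]
  simp only [hΦ, intervalIntegral.integral_same, mul_zero, sub_zero, hVb] at hVΦ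
  have hfb : ‖f b * ∫ u in a..b, g u‖ ≤ ‖f b‖ * ε := by
    rw [norm_mul]; gcongr; exact hε b hb
  linarith [norm_le_norm_sub_add (∫ u in a..b, f u * g u) (f b * ∫ u in a..b, g u)]

theorem exists_norm_integral_mul_exp_le {f : ℝ → ℂ} (hf : BoundedVariationOn f (Icc a b)) (B : ℝ) :
    ∃ C, 0 ≤ C ∧ ∀ κ : ℂ, κ ≠ 0 → (∀ u ∈ Icc a b, ‖Complex.exp (κ * u)‖ ≤ B) →
      ∀ x ∈ Icc a b, ‖∫ u in a..x, f u * Complex.exp (κ * u)‖ ≤ C / ‖κ‖ := by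
  obtain ⟨M, hM0, hM⟩ := exists_norm_le_of_boundedVariationOn hf
  refine ⟨(M + (eVariationOn f (Icc a b)).toReal) * (2 * |B|), by positivity,
    fun κ hκ hB x hx => ?_⟩
  have hsub : Icc a x ⊆ Icc a b := Icc_subset_Icc_right hx.2
  have hexp : ∀ y ∈ Icc a x, ‖∫ u in a..y, Complex.exp (κ * u)‖ ≤ 2 * |B| / ‖κ‖ := fun y hy => by
    have ha := hB a (left_mem_Icc.2 (hx.1.trans hx.2))
    have hle := (norm_sub_le _ _).trans (add_le_add (hB y (hsub hy)) ha)
    rw [integral_exp_mul_complex hκ, norm_div]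
    gcongr
    linarith [le_abs_self B]
  have hint := norm_integral_mul_le_of_boundedVariationOn hx.1 (hf.mono hsub)
    (Continuous.continuousOn (by fun_prop)) hexp
  refine hint.trans ?_
  rw [mul_div_assoc _ (2 * |B|)]
  gcongr
  · exact hM x hx
  · exact eVariationOn.mono f hsub

end BoundedVariation

noncomputable section LinearODE

variable {V : Type*} [NormedAddCommGroup V] [NormedSpace ℂ V] {A B : ℝ → V →L[ℂ] V} {a b : ℝ}

theorem intervalIntegrable_clm_apply (hA : IntervalIntegrable A volume a b) {f : ℝ → V}
    (hf : ContinuousOn f (uIcc a b)) : IntervalIntegrable (fun u => A u (f u)) volume a b := by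
  obtain ⟨K, hK⟩ := isCompact_uIcc.exists_bound_of_continuousOn hf
  refine (hA.norm.mul_const K).mono_fun' ?_ ?_
  · exact (ContinuousLinearMap.id ℂ (V →L[ℂ] V)).aestronglyMeasurable_comp₂
      hA.aestronglyMeasurable_restrict_uIoc
      ((hf.mono uIoc_subset_uIcc).aestronglyMeasurable measurableSet_uIoc)
  · filter_upwards [ae_restrict_mem measurableSet_uIoc] with u hu
    exact (A u).le_opNorm_of_le (hK u (uIoc_subset_uIcc hu))

theorem intervalIntegrable_clm_apply_IccExtend (hab : a ≤ b) (hA : IntervalIntegrable A volume a b)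
    (f : C(Icc a b, V)) (x : Icc a b) :
    IntervalIntegrable (fun u => A u (IccExtend hab f u)) volume a x :=
  (intervalIntegrable_clm_apply hA f.continuous.Icc_extend'.continuousOn).mono_set
    (uIcc_subset_uIcc_left (by simp only [uIcc_of_le hab, x.2]))

theorem norm_integral_clm_apply_IccExtend_le (hab : a ≤ b) (hA : IntervalIntegrable A volume a b)
    (f : C(Icc a b, V)) {φ : ℝ → ℝ} (hφ : ContinuousOn φ (Icc a b)) (hfφ : ∀ x, ‖f x‖ ≤ φ x)
    (x : Icc a b) :
    ‖∫ u in a..x, A u (IccExtend hab f u)‖ ≤ ∫ u in a..x, ‖A u‖ * φ u := by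
  have hsub : uIcc a (x : ℝ) ⊆ Icc a b := by
    rw [uIcc_of_le x.2.1]; exact Icc_subset_Icc_right x.2.2
  refine intervalIntegral.norm_integral_le_of_norm_le x.2.1 (.of_forall fun u hu => ?_)
    ((hA.norm.mono_set (by rwa [uIcc_of_le hab])).mul_continuousOn (hφ.mono hsub))
  have hu' : u ∈ Icc a b := ⟨hu.1.le, hu.2.trans x.2.2⟩
  rw [IccExtend_of_mem _ _ hu']
  exact (A u).le_opNorm_of_le (hfφ ⟨u, hu'⟩)

/-- The Volterra integral operator `f ↦ (x ↦ ∫ₐˣ A(u) f(u) du)` on `C([a, b], V)`; functions on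
`[a, b]` are extended by constants to be integrated. -/
def volterra (hab : a ≤ b) (hA : IntervalIntegrable A volume a b) :
    C(Icc a b, V) →L[ℂ] C(Icc a b, V) :=
  LinearMap.mkContinuous
    { toFun := fun f =>
        { toFun := fun x => ∫ u in a..x, A u (IccExtend hab f u)
          continuous_toFun := by
            have hc := intervalIntegral.continuousOn_primitive_interval'
              (intervalIntegrable_clm_apply hA (f := IccExtend hab f)
                f.continuous.Icc_extend'.continuousOn) left_mem_uIcc
            exact hc.comp_continuous continuous_subtype_val fun x => by
              simp only [uIcc_of_le hab, x.2] }
      map_add' := fun f g => by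
        ext x
        refine Eq.trans ?_ (intervalIntegral.integral_add
          (intervalIntegrable_clm_apply_IccExtend hab hA f x)
          (intervalIntegrable_clm_apply_IccExtend hab hA g x))
        simp [IccExtend]
      map_smul' := fun r f => by
        ext x
        refine Eq.trans ?_ (intervalIntegral.integral_smul r _)
        simp [IccExtend] }
    (∫ u in a..b, ‖A u‖) fun f => by
      have h0 : 0 ≤ ∫ u in a..b, ‖A u‖ :=
        intervalIntegral.integral_nonneg hab fun u _ => norm_nonneg _
      refine (ContinuousMap.norm_le _ (by positivity)).2 fun x => ?_
      refine (norm_integral_clm_apply_IccExtend_le hab hA f continuousOn_const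
        f.norm_coe_le_norm x).trans ?_
      rw [intervalIntegral.integral_mul_const]
      gcongr
      exact intervalIntegral.integral_mono_interval le_rfl x.2.1 x.2.2
        (.of_forall fun _ => norm_nonneg _) hA.norm

theorem volterra_apply (hab : a ≤ b) (hA : IntervalIntegrable A volume a b) (f : C(Icc a b, V))
    (x : Icc a b) : volterra hab hA f x = ∫ u in a..x, A u (IccExtend hab f u) := rfl

theorem volterra_add_smul (hab : a ≤ b) (hA : IntervalIntegrable A volume a b)
    (hB : IntervalIntegrable B volume a b) (z : ℂ) :
    volterra hab (hA.add (hB.smul z)) = volterra hab hA + z • volterra hab hB := by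
  ext f x
  refine Eq.trans ?_ ((intervalIntegral.integral_add
    (intervalIntegrable_clm_apply_IccExtend hab hA f x)
    ((intervalIntegrable_clm_apply_IccExtend hab hB f x).smul z)).trans
    (congrArg _ (intervalIntegral.integral_smul z _)))
  rfl

theorem integral_mul_primitive_pow {φ : ℝ → ℝ} {x : ℝ} (hφ : IntervalIntegrable φ volume a x)
    (n : ℕ) : ∫ u in a..x, φ u * (∫ v in a..u, φ v) ^ n
      = (∫ v in a..x, φ v) ^ (n + 1) / (n + 1) := by
  set m : ℝ → ℝ := fun u => ∫ v in a..u, φ v with hm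
  have hmac : AbsolutelyContinuousOnInterval m a x := absolutelyContinuousOnInterval_primitive hφ
  have hpow : ∀ k : ℕ, AbsolutelyContinuousOnInterval (fun u => m u ^ k) a x := by
    intro k
    induction k with
    | zero => simpa only [pow_zero] using absolutelyContinuousOnInterval_const (1 : ℝ) a x
    | succ k ih => simpa only [pow_succ] using ih.fun_mul hmac
  have hd : ∀ᵐ u, u ∈ uIcc a x →
      HasDerivAt (fun u => m u ^ (n + 1)) ((n + 1) * (φ u * m u ^ n)) u := by
    filter_upwards [hφ.ae_hasDerivAt_integral] with u hu hux
    refine ((hu hux a left_mem_uIcc).pow (n + 1)).congr_deriv ?_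
    simp only [hm, Nat.add_sub_cancel]
    push_cast
    ring
  have hftc := sub_eq_integral_of_ae_hasDerivAt (hpow (n + 1))
    ((hφ.mul_continuousOn (hpow n).continuousOn).const_mul _) hd right_mem_uIcc
  rw [intervalIntegral.integral_const_mul, hm] at hftc
  simp only [intervalIntegral.integral_same, ne_eq, Nat.add_eq_zero_iff, one_ne_zero, and_false,
    not_false_eq_true, zero_pow, sub_zero] at hftc
  rw [eq_div_iff (by positivity), mul_comm, ← hftc]

theorem norm_volterra_pow_apply_le (hab : a ≤ b) (hA : IntervalIntegrable A volume a b) (n : ℕ)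
    (f : C(Icc a b, V)) (x : Icc a b) :
    ‖(volterra hab hA ^ n) f x‖ ≤ ‖f‖ / n.factorial * (∫ u in a..x, ‖A u‖) ^ n := by
  induction n generalizing x with
  | zero => simpa using f.norm_coe_le_norm x
  | succ n ih =>
    have hm : ContinuousOn (fun x => ∫ u in a..x, ‖A u‖) (Icc a b) := by
      rw [← uIcc_of_le hab]
      exact (absolutelyContinuousOnInterval_primitive hA.norm).continuousOn
    have hx : (x : ℝ) ∈ uIcc a b := by simp only [uIcc_of_le hab, x.2]
    have hφ : ContinuousOn
        (fun u => ‖f‖ / n.factorial * (∫ v in a..u, ‖A v‖) ^ n) (Icc a b) :=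
      (hm.pow n).const_mul _
    rw [pow_succ', mul_apply_eq_comp, volterra_apply]
    refine (norm_integral_clm_apply_IccExtend_le hab hA _ hφ ih x).trans_eq ?_
    simp only [mul_left_comm ‖A _‖]
    rw [intervalIntegral.integral_const_mul, integral_mul_primitive_pow
      (hA.norm.mono_set (uIcc_subset_uIcc_left hx)), Nat.factorial_succ]
    push_cast
    field_simp

theorem isUnit_one_sub_of_norm_pow_lt_one {R : Type*} [NormedRing R] [HasSummableGeomSeries R]
    {T : R} {n : ℕ} (h : ‖T ^ n‖ < 1) : IsUnit (1 - T) := by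
  have hu : IsUnit (1 - T ^ n) := (Units.oneSub (T ^ n) h).isUnit
  rw [← mul_neg_geom_sum T n] at hu
  refine ((Commute.isUnit_mul_iff ?_).1 hu).1
  rw [commute_iff_eq, mul_neg_geom_sum, geom_sum_mul_neg]

theorem isUnit_one_sub_volterra [CompleteSpace V] (hab : a ≤ b)
    (hA : IntervalIntegrable A volume a b) : IsUnit (1 - volterra hab hA) := by
  set m := ∫ u in a..b, ‖A u‖
  obtain ⟨n, hn⟩ : ∃ n : ℕ, m ^ n / n.factorial < 1 :=
    ((FloorSemiring.tendsto_pow_div_factorial_atTop m).eventually (gt_mem_nhds one_pos)).exists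
  have hx0 : ∀ x ∈ Icc a b, 0 ≤ ∫ u in a..x, ‖A u‖ := fun x hx =>
    intervalIntegral.integral_nonneg hx.1 fun u _ => norm_nonneg _
  have hm0 : 0 ≤ m := hx0 b (right_mem_Icc.2 hab)
  suffices h : ‖volterra hab hA ^ n‖ < 1 from
    isUnit_one_sub_of_norm_pow_lt_one (T := volterra hab hA) h
  refine (ContinuousLinearMap.opNorm_le_bound _ (by positivity) fun f => ?_).trans_lt hn
  refine (ContinuousMap.norm_le _ (by positivity)).2 fun x =>
    (norm_volterra_pow_apply_le hab hA n f x).trans ?_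
  rw [div_mul_comm, div_mul_eq_mul_div, div_mul_eq_mul_div]
  gcongr
  · exact hx0 x x.2
  · exact intervalIntegral.integral_mono_interval le_rfl x.2.1 x.2.2
      (.of_forall fun _ => norm_nonneg _) hA.norm

theorem differentiable_inverse_one_sub_add_smul_apply {E : Type*} [NormedAddCommGroup E]
    [NormedSpace ℂ E] [CompleteSpace E] {S T : E →L[ℂ] E}
    (h : ∀ z : ℂ, IsUnit (1 - (S + z • T))) (v : E) :
    Differentiable ℂ fun z : ℂ => (Ring.inverse (1 - (S + z • T)) : E →L[ℂ] E) v := fun z => by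
  have hinv : DifferentiableAt ℂ (fun z : ℂ => (Ring.inverse (1 - (S + z • T)) : E →L[ℂ] E)) z :=
    DifferentiableAt.fun_comp' z (differentiableAt_inverse (𝕜 := ℂ) (h z)) (by fun_prop)
  exact hinv.clm_apply (differentiableAt_const v)

/-- `y` solves the linear differential equation `y' = A(x) y` on the interval between `a` and `b`
in the sense of Carathéodory: it is absolutely continuous and the equation holds almost
everywhere. -/
def IsCaratheodorySolution (A : ℝ → V →L[ℂ] V) (a b : ℝ) (y : ℝ → V) : Prop :=
  AbsolutelyContinuousOnInterval y a b ∧ ∀ᵐ x, x ∈ uIcc a b → HasDerivAt y (A x (y x)) x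

variable [CompleteSpace V]

theorem isCaratheodorySolution_of_eq_integral (hab : a ≤ b) (hA : IntervalIntegrable A volume a b)
    {y : ℝ → V} (hy : ContinuousOn y (Icc a b)) {v : V}
    (h : ∀ x ∈ Icc a b, y x = v + ∫ u in a..x, A u (y u)) :
    IsCaratheodorySolution A a b y := by
  rw [← uIcc_of_le hab] at hy h
  have hi := intervalIntegrable_clm_apply hA hy
  refine ⟨absolutelyContinuousOnInterval_of_dist_le 1
    (absolutelyContinuousOnInterval_primitive hi) fun x hx z hz => ?_, ?_⟩
  · rw [h x hx, h z hz, dist_add_left, one_mul]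
  · filter_upwards [hi.ae_hasDerivAt_integral, Measure.ae_ne volume a, Measure.ae_ne volume b]
      with x hx hxa hxb hm
    refine ((hx hm a left_mem_uIcc).const_add v).congr_of_eventuallyEq ?_
    rw [uIcc_of_le hab] at hm h
    filter_upwards [Icc_mem_nhds (hm.1.lt_of_ne hxa.symm) (hm.2.lt_of_ne hxb)] with z hz
      using h z hz

/-- The solution of `y' = A(x) y`, `y(a) = v`, as a continuous function on `[a, b]`. -/
def caratheodorySolution (hab : a ≤ b) (hA : IntervalIntegrable A volume a b) (v : V) :
    C(Icc a b, V) :=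
  Ring.inverse (1 - volterra hab hA) (ContinuousMap.const _ v)

theorem caratheodorySolution_apply (hab : a ≤ b) (hA : IntervalIntegrable A volume a b) (v : V)
    (x : Icc a b) : caratheodorySolution hab hA v x
      = v + ∫ u in a..x, A u (IccExtend hab (caratheodorySolution hab hA v) u) := by
  have h := congrArg (fun S => S (ContinuousMap.const _ v) x)
    (Ring.mul_inverse_cancel _ (isUnit_one_sub_volterra hab hA))
  exact sub_eq_iff_eq_add.1 h

theorem isCaratheodorySolution_caratheodorySolution (hab : a ≤ b)
    (hA : IntervalIntegrable A volume a b) (v : V) :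
    IsCaratheodorySolution A a b (IccExtend hab (caratheodorySolution hab hA v)) :=
  isCaratheodorySolution_of_eq_integral hab hA (ContinuousMap.continuous _).Icc_extend'.continuousOn
    fun x hx => by
      rw [IccExtend_of_mem _ _ hx]
      exact caratheodorySolution_apply hab hA v ⟨x, hx⟩

theorem caratheodorySolution_left (hab : a ≤ b) (hA : IntervalIntegrable A volume a b) (v : V) :
    caratheodorySolution hab hA v ⟨a, left_mem_Icc.2 hab⟩ = v := by
  rw [caratheodorySolution_apply, intervalIntegral.integral_same, add_zero]

theorem eqOn_caratheodorySolution (hab : a ≤ b) (hA : IntervalIntegrable A volume a b) {y : ℝ → V}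
    (hy : IsCaratheodorySolution A a b y) :
    EqOn y (IccExtend hab (caratheodorySolution hab hA (y a))) (Icc a b) := by
  have hyc : ContinuousOn y (Icc a b) := by rw [← uIcc_of_le hab]; exact hy.1.continuousOn
  set f : C(Icc a b, V) := ⟨(Icc a b).domRestrict y, hyc.domRestrict⟩
  have hf : (1 - volterra hab hA) f = ContinuousMap.const _ (y a) := by
    ext x
    have hx : (x : ℝ) ∈ uIcc a b := by simp only [uIcc_of_le hab, x.2]
    have hint : volterra hab hA f x = ∫ u in a..x, A u (y u) :=
      intervalIntegral.integral_congr fun u hu => by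
        rw [uIcc_of_le x.2.1] at hu
        rw [IccExtend_of_mem _ _ ⟨hu.1, hu.2.trans x.2.2⟩]
        rfl
    have hftc := sub_eq_integral_of_ae_hasDerivAt hy.1
      (intervalIntegrable_clm_apply hA hy.1.continuousOn) hy.2 hx
    refine (congrArg (y x - ·) hint).trans ?_
    rw [← hftc, sub_sub_cancel]
    rfl
  have hinv := congrArg (fun S => S f)
    (Ring.inverse_mul_cancel _ (isUnit_one_sub_volterra hab hA))
  have hsol : caratheodorySolution hab hA (y a) = f := by
    rw [caratheodorySolution, ← hf]
    exact hinv
  intro x hx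
  rw [IccExtend_of_mem _ _ hx, hsol]
  rfl

theorem differentiable_caratheodorySolution (hab : a ≤ b) (hA : IntervalIntegrable A volume a b)
    (hB : IntervalIntegrable B volume a b) (v : V) :
    Differentiable ℂ fun z : ℂ => caratheodorySolution hab (hA.add (hB.smul z)) v := by
  have hu : ∀ z : ℂ, IsUnit (1 - (volterra hab hA + z • volterra hab hB)) := fun z => by
    rw [← volterra_add_smul]
    exact isUnit_one_sub_volterra hab (hA.add (hB.smul z))
  exact fun z => (differentiable_inverse_one_sub_add_smul_apply hu
    (ContinuousMap.const _ v) z).congr_of_eventuallyEq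
      (.of_forall fun w => by simp only [← volterra_add_smul]; rfl)

end LinearODE

noncomputable section FundamentalSolutions

namespace Dirac

variable {p q : ℝ → ℂ} {lam : ℂ}

/-- The operator on `ℂ²` given by a matrix. -/
def matrixCLM (X : Matrix (Fin 2) (Fin 2) ℂ) : (Fin 2 → ℂ) →L[ℂ] (Fin 2 → ℂ) :=
  X.mulVecLin.toContinuousLinearMap

/-- The operator `J Q(x)`, which is the coefficient of the equation `y' = J Q(x) y`, that is
`J y' + Q y = 0`. -/
def potential (p q : ℝ → ℂ) (x : ℝ) : (Fin 2 → ℂ) →L[ℂ] (Fin 2 → ℂ) :=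
  p x • matrixCLM !![0, -1; -1, 0] + q x • matrixCLM !![1, 0; 0, -1]

/-- The coefficient of the equation `J y' + Q y = lam y`, solved for `y'`. -/
def generator (p q : ℝ → ℂ) (lam : ℂ) (x : ℝ) : (Fin 2 → ℂ) →L[ℂ] (Fin 2 → ℂ) :=
  potential p q x + lam • matrixCLM !![0, -1; 1, 0]

theorem generator_apply (x : ℝ) (v : Fin 2 → ℂ) : generator p q lam x v =
    ![q x * v 0 - (lam + p x) * v 1, (lam - p x) * v 0 - q x * v 1] := by
  ext i
  fin_cases i <;>
  simp [generator, potential, matrixCLM, dotProduct, Fin.sum_univ_two] <;> ring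

theorem J_mulVec_add_eq_smul_iff (x : ℝ) (v w : Fin 2 → ℂ) :
    J *ᵥ w + Q p q x *ᵥ v = lam • v ↔ w = generator p q lam x v := by
  rw [generator_apply]
  simp only [funext_iff, Fin.forall_fin_two, J, Q, Matrix.mulVec, dotProduct, Fin.sum_univ_two,
    Pi.add_apply, Pi.smul_apply, smul_eq_mul, Matrix.cons_val_zero, Matrix.cons_val_one,
    Matrix.of_apply, Matrix.cons_val', Matrix.cons_val_fin_one]
  constructor
  · rintro ⟨h0, h1⟩
    exact ⟨by linear_combination -h1, by linear_combination h0⟩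
  · rintro ⟨h0, h1⟩
    exact ⟨by linear_combination h1, by linear_combination -h0⟩

theorem isSolution_iff {y : ℝ → Fin 2 → ℂ} :
    IsSolution p q lam y ↔ IsCaratheodorySolution (generator p q lam) 0 π y := by
  rw [IsSolution, IsCaratheodorySolution, ae_restrict_iff' measurableSet_Icc,
    uIcc_of_le Real.pi_nonneg]
  refine and_congr_right fun _ => eventually_congr (.of_forall fun x => imp_congr_right fun _ => ?_)
  rw [J_mulVec_add_eq_smul_iff]
  exact ⟨fun h => h.2 ▸ h.1.hasDerivAt, fun h => ⟨h.differentiableAt, h.deriv⟩⟩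

theorem IsSolution.add {y z : ℝ → Fin 2 → ℂ} (hy : IsSolution p q lam y)
    (hz : IsSolution p q lam z) : IsSolution p q lam (y + z) := by
  rw [isSolution_iff] at *
  refine ⟨hy.1.add hz.1, ?_⟩
  filter_upwards [hy.2, hz.2] with x hyx hzx hx
  exact ((hyx hx).add (hzx hx)).congr_deriv (map_add _ _ _).symm

theorem IsSolution.const_smul {y : ℝ → Fin 2 → ℂ} (hy : IsSolution p q lam y) (r : ℂ) :
    IsSolution p q lam (r • y) := by
  rw [isSolution_iff] at *
  refine ⟨hy.1.const_smul r, ?_⟩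
  filter_upwards [hy.2] with x hyx hx
  exact ((hyx hx).const_smul r).congr_deriv (map_smul _ _ _).symm

theorem IsSolution.wronskian_eq {y z : ℝ → Fin 2 → ℂ} (hy : IsSolution p q lam y)
    (hz : IsSolution p q lam z) {x : ℝ} (hx : x ∈ Icc 0 π) :
    y x 0 * z x 1 - y x 1 * z x 0 = y 0 0 * z 0 1 - y 0 1 * z 0 0 := by
  rw [isSolution_iff] at hy hz
  have hy_ac := absolutelyContinuousOnInterval_apply hy.1
  have hz_ac := absolutelyContinuousOnInterval_apply hz.1
  have hac : AbsolutelyContinuousOnInterval (fun x => y x 0 * z x 1 - y x 1 * z x 0) 0 π :=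
    ((hy_ac 0).fun_smul (hz_ac 1)).fun_sub ((hy_ac 1).fun_smul (hz_ac 0))
  have hderiv : ∀ᵐ u, u ∈ uIcc 0 π → HasDerivAt (fun x => y x 0 * z x 1 - y x 1 * z x 0) 0 u := by
    filter_upwards [hy.2, hz.2] with u hyu hzu hu
    have hyu := hasDerivAt_pi.1 (hyu hu)
    have hzu := hasDerivAt_pi.1 (hzu hu)
    refine (((hyu 0).fun_mul (hzu 1)).fun_sub ((hyu 1).fun_mul (hzu 0))).congr_deriv ?_
    simp only [generator_apply, Matrix.cons_val_zero, Matrix.cons_val_one]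
    ring
  have hconst := sub_eq_integral_of_ae_hasDerivAt hac intervalIntegrable_const hderiv
    (Icc_subset_uIcc hx)
  rwa [intervalIntegral.integral_zero, sub_eq_zero] at hconst

variable (hp : BoundedVariationOn p (Icc 0 π)) (hq : BoundedVariationOn q (Icc 0 π))
include hp hq

theorem intervalIntegrable_potential : IntervalIntegrable (potential p q) volume 0 π := by
  rw [← uIcc_of_le Real.pi_nonneg] at hp hq
  have hsmul : ∀ {f : ℝ → ℂ}, IntervalIntegrable f volume 0 π →
      ∀ T : (Fin 2 → ℂ) →L[ℂ] (Fin 2 → ℂ), IntervalIntegrable (fun x => f x • T) volume 0 π :=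
    fun hf T => ⟨hf.1.smul_const T, hf.2.smul_const T⟩
  exact (hsmul (intervalIntegrable_of_boundedVariationOn hp) _).add
    (hsmul (intervalIntegrable_of_boundedVariationOn hq) _)

theorem intervalIntegrable_generator (lam : ℂ) :
    IntervalIntegrable (generator p q lam) volume 0 π :=
  (intervalIntegrable_potential hp hq).add 
    ((intervalIntegrable_const (c := matrixCLM !![0, -1; 1, 0])).smul lam)

theorem isSolution_solution (lam : ℂ) (v : Fin 2 → ℂ) :
    IsSolution p q lam (solution p q lam v) ∧ solution p q lam v 0 = v := by
  have hA := intervalIntegrable_generator hp hq lam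
  refine Classical.epsilon_spec (p := fun y => IsSolution p q lam y ∧ y 0 = v)
    ⟨_, isSolution_iff.2 (isCaratheodorySolution_caratheodorySolution Real.pi_nonneg hA v), ?_⟩
  rw [IccExtend_left]
  exact caratheodorySolution_left Real.pi_nonneg hA v

theorem IsSolution.eqOn {y z : ℝ → Fin 2 → ℂ} (hy : IsSolution p q lam y)
    (hz : IsSolution p q lam z) (h0 : y 0 = z 0) : EqOn y z (Icc 0 π) := by
  have hA := intervalIntegrable_generator hp hq lam
  refine (eqOn_caratheodorySolution Real.pi_nonneg hA (isSolution_iff.1 hy)).trans ?_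
  rw [h0]
  exact (eqOn_caratheodorySolution Real.pi_nonneg hA (isSolution_iff.1 hz)).symm

theorem differentiable_solution (v : Fin 2 → ℂ) {x : ℝ} (hx : x ∈ Icc 0 π) (i : Fin 2) :
    Differentiable ℂ fun lam => solution p q lam v x i := by
  have hdiff := differentiable_caratheodorySolution Real.pi_nonneg
    (intervalIntegrable_potential hp hq)
    (intervalIntegrable_const (c := matrixCLM !![0, -1; 1, 0])) v
  have heval := (ContinuousLinearMap.proj (R := ℂ) (φ := fun _ : Fin 2 => ℂ) i).differentiable.comp
    ((ContinuousMap.evalCLM (M := Fin 2 → ℂ) ℂ (⟨x, hx⟩ : Icc 0 π)).differentiable.comp hdiff)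
  refine fun z => (heval z).congr_of_eventuallyEq (.of_forall fun lam => ?_)
  obtain ⟨hsol, h0⟩ := isSolution_solution hp hq lam v
  have heq := eqOn_caratheodorySolution Real.pi_nonneg (intervalIntegrable_generator hp hq lam)
    (isSolution_iff.1 hsol) hx
  rw [h0, IccExtend_of_mem _ _ hx] at heq
  exact congrFun heq i

end Dirac

end FundamentalSolutions

section CoupledSystem

variable {𝕜 : Type*} [RCLike 𝕜] {α β U V : ℝ → 𝕜} {a b M ε : ℝ}

/-- `α` is bounded by `M` on `[a, b]`, while its primitive is bounded by `ε`; the case of interest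
is that of an oscillating function `α`, for which `ε` is much smaller than `(b - a) * M`. -/
structure IsOscillating (α : ℝ → 𝕜) (a b M ε : ℝ) : Prop where
  intervalIntegrable : IntervalIntegrable α volume a b
  norm_le : ∀ x ∈ Icc a b, ‖α x‖ ≤ M
  norm_integral_le : ∀ x ∈ Icc a b, ‖∫ u in a..x, α u‖ ≤ ε

theorem IsOscillating.add {M' ε' : ℝ} (hα : IsOscillating α a b M ε)
    (hβ : IsOscillating β a b M' ε') :
    IsOscillating (fun x => α x + β x) a b (M + M') (ε + ε') where
  intervalIntegrable := hα.intervalIntegrable.add hβ.intervalIntegrable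
  norm_le x hx := norm_add_le_of_le (hα.norm_le x hx) (hβ.norm_le x hx)
  norm_integral_le x hx := by
    have hsub : uIcc a x ⊆ uIcc a b := uIcc_subset_uIcc_left (Icc_subset_uIcc hx)
    rw [intervalIntegral.integral_add (hα.intervalIntegrable.mono_set hsub)
      (hβ.intervalIntegrable.mono_set hsub)]
    exact norm_add_le_of_le (hα.norm_integral_le x hx) (hβ.norm_integral_le x hx)

theorem IsOscillating.const_mul (hα : IsOscillating α a b M ε) (k : 𝕜) :
    IsOscillating (fun x => k * α x) a b (‖k‖ * M) (‖k‖ * ε) where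
  intervalIntegrable := hα.intervalIntegrable.const_mul k
  norm_le x hx := by
    rw [norm_mul]
    gcongr
    exact hα.norm_le x hx
  norm_integral_le x hx := by
    rw [intervalIntegral.integral_const_mul, norm_mul]
    gcongr
    exact hα.norm_integral_le x hx

theorem exists_isOscillating_mul_exp {f : ℝ → ℂ} (hab : a ≤ b)
    (hf : BoundedVariationOn f (Icc a b)) (B : ℝ) :
    ∃ M C, 0 ≤ M ∧ 0 ≤ C ∧ ∀ κ : ℂ, κ ≠ 0 → (∀ u ∈ Icc a b, ‖Complex.exp (κ * u)‖ ≤ B) →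
      IsOscillating (fun u => f u * Complex.exp (κ * u)) a b M (C / ‖κ‖) := by
  obtain ⟨M, hM0, hM⟩ := exists_norm_le_of_boundedVariationOn hf
  obtain ⟨C, hC0, hC⟩ := exists_norm_integral_mul_exp_le hf B
  refine ⟨M * |B|, C, by positivity, hC0, fun κ hκ hB => ⟨?_, fun x hx => ?_, hC κ hκ hB⟩⟩
  · rw [← uIcc_of_le hab] at hf
    exact (intervalIntegrable_of_boundedVariationOn hf).mul_continuousOn
      (Continuous.continuousOn (by fun_prop))
  · rw [norm_mul]
    exact mul_le_mul (hM x hx) ((hB x hx).trans (le_abs_self B)) (norm_nonneg _) hM0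

/-- `U` and `V` solve the coupled system `U' = α V`, `V' = β U` on the interval between `a` and `b`
in the sense of Carathéodory. -/
structure IsCoupledSolution (α β U V : ℝ → 𝕜) (a b : ℝ) : Prop where
  left_ac : AbsolutelyContinuousOnInterval U a b
  right_ac : AbsolutelyContinuousOnInterval V a b
  left_hasDerivAt : ∀ᵐ x, x ∈ uIcc a b → HasDerivAt U (α x * V x) x
  right_hasDerivAt : ∀ᵐ x, x ∈ uIcc a b → HasDerivAt V (β x * U x) x

namespace IsCoupledSolution

theorem symm (h : IsCoupledSolution α β U V a b) : IsCoupledSolution β α V U a b :=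
  ⟨h.right_ac, h.left_ac, h.right_hasDerivAt, h.left_hasDerivAt⟩

-- Integration by parts: `U - (∫ α) V` has the derivative `-(∫ α) β U`, in which the unintegrated
-- `α` no longer occurs.
theorem sub_eq (h : IsCoupledSolution α β U V a b) (hα : IntervalIntegrable α volume a b)
    (hβ : IntervalIntegrable β volume a b) {x : ℝ} (hx : x ∈ uIcc a b) :
    U x - U a = (∫ u in a..x, α u) * V x - ∫ u in a..x, β u * ((∫ v in a..u, α v) * U u) := by
  set A : ℝ → 𝕜 := fun x => ∫ u in a..x, α u with hA
  have hA_ac : AbsolutelyContinuousOnInterval A a b := absolutelyContinuousOnInterval_primitive hα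
  have hderiv : ∀ᵐ u, u ∈ uIcc a b →
      HasDerivAt (fun u => U u - A u * V u) (-(β u * (A u * U u))) u := by
    filter_upwards [h.left_hasDerivAt, h.right_hasDerivAt, hα.ae_hasDerivAt_integral]
      with u hU hV hAu hu
    exact ((hU hu).fun_sub ((hAu hu a left_mem_uIcc).fun_mul (hV hu))).congr_deriv (by ring)
  have hint : IntervalIntegrable (fun u => -(β u * (A u * U u))) volume a b :=
    (hβ.mul_continuousOn (hA_ac.continuousOn.mul h.left_ac.continuousOn)).neg
  have hftc := sub_eq_integral_of_ae_hasDerivAt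
    (h.left_ac.fun_sub (hA_ac.fun_smul h.right_ac)) hint hderiv hx
  simp only [hA, intervalIntegral.integral_same, zero_mul, sub_zero, smul_eq_mul,
    intervalIntegral.integral_neg] at hftc
  linear_combination hftc

theorem norm_sub_le (h : IsCoupledSolution α β U V a b) (hα : IsOscillating α a b M ε)
    (hβ : IsOscillating β a b M ε) {N : ℝ} (hU : ∀ x ∈ Icc a b, ‖U x‖ ≤ N)
    (hV : ∀ x ∈ Icc a b, ‖V x‖ ≤ N) {x : ℝ} (hx : x ∈ Icc a b) :
    ‖U x - U a‖ ≤ ε * (1 + (b - a) * M) * N := by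
  have hM0 : 0 ≤ M := (norm_nonneg _).trans (hα.norm_le x hx)
  have hN0 : 0 ≤ N := (norm_nonneg _).trans (hU x hx)
  have hε0 : 0 ≤ ε := (norm_nonneg _).trans (hα.norm_integral_le x hx)
  have hprod : ‖(∫ u in a..x, α u) * V x‖ ≤ ε * N := by
    rw [norm_mul]
    exact mul_le_mul (hα.norm_integral_le x hx) (hV x hx) (norm_nonneg _) hε0
  have hint : ‖∫ u in a..x, β u * ((∫ v in a..u, α v) * U u)‖ ≤ M * (ε * N) * |x - a| := by
    refine intervalIntegral.norm_integral_le_of_norm_le_const fun u hu => ?_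
    rw [uIoc_of_le hx.1] at hu
    have hu' : u ∈ Icc a b := ⟨hu.1.le, hu.2.trans hx.2⟩
    rw [norm_mul, norm_mul]
    gcongr
    exacts [hβ.norm_le u hu', hα.norm_integral_le u hu', hU u hu']
  rw [h.sub_eq hα.intervalIntegrable hβ.intervalIntegrable (Icc_subset_uIcc hx)]
  calc _ ≤ ε * N + M * (ε * N) * |x - a| := norm_sub_le_of_le hprod hint
    _ ≤ ε * N + M * (ε * N) * (b - a) := by
      gcongr
      rw [abs_of_nonneg (sub_nonneg.2 hx.1)]
      linarith [hx.2]
    _ = ε * (1 + (b - a) * M) * N := by ring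

theorem norm_sub_le_of_le_half (h : IsCoupledSolution α β U V a b) (hα : IsOscillating α a b M ε)
    (hβ : IsOscillating β a b M ε) (hε : ε * (1 + (b - a) * M) ≤ 1 / 2) {x : ℝ}
    (hx : x ∈ Icc a b) :
    ‖U x - U a‖ ≤ 2 * (ε * (1 + (b - a) * M)) * max ‖U a‖ ‖V a‖ := by
  have hab : a ≤ b := hx.1.trans hx.2
  have hM0 : 0 ≤ M := (norm_nonneg _).trans (hα.norm_le x hx)
  have hε0 : 0 ≤ ε := (norm_nonneg _).trans (hα.norm_integral_le x hx)
  have : 0 ≤ b - a := sub_nonneg.2 hab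
  have hUc : ContinuousOn U (Icc a b) := by rw [← uIcc_of_le hab]; exact h.left_ac.continuousOn
  have hVc : ContinuousOn V (Icc a b) := by rw [← uIcc_of_le hab]; exact h.right_ac.continuousOn
  obtain ⟨z, hz, hmax⟩ := isCompact_Icc.exists_isMaxOn ⟨x, hx⟩ (hUc.norm.sup hVc.norm)
  set N := max ‖U z‖ ‖V z‖
  have hUN : ∀ x ∈ Icc a b, ‖U x‖ ≤ N := fun x hx => (le_max_left _ _).trans (hmax hx)
  have hVN : ∀ x ∈ Icc a b, ‖V x‖ ≤ N := fun x hx => (le_max_right _ _).trans (hmax hx)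
  have hN0 : 0 ≤ N := (norm_nonneg _).trans (hUN x hx)
  have hself : N ≤ max ‖U a‖ ‖V a‖ + ε * (1 + (b - a) * M) * N := max_le
    (by linarith [h.norm_sub_le hα hβ hUN hVN hz, norm_le_norm_sub_add (U z) (U a),
      le_max_left ‖U a‖ ‖V a‖])
    (by linarith [h.symm.norm_sub_le hβ hα hVN hUN hz, norm_le_norm_sub_add (V z) (V a),
      le_max_right ‖U a‖ ‖V a‖])
  have hN2 : N ≤ 2 * max ‖U a‖ ‖V a‖ := by nlinarith
  calc ‖U x - U a‖ ≤ ε * (1 + (b - a) * M) * N := h.norm_sub_le hα hβ hUN hVN hx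
    _ ≤ ε * (1 + (b - a) * M) * (2 * max ‖U a‖ ‖V a‖) := by gcongr
    _ = 2 * (ε * (1 + (b - a) * M)) * max ‖U a‖ ‖V a‖ := by ring

end IsCoupledSolution

end CoupledSystem

noncomputable section FreeAsymptotics

section Exponential

variable {j θ : ℂ}

theorem eq_I_or_eq_neg_I_of_mul_self_eq_neg_one (hj : j * j = -1) :
    j = Complex.I ∨ j = -Complex.I := by
  rwa [← Complex.I_mul_I, mul_self_eq_mul_self_iff] at hj

theorem norm_eq_one_of_mul_self_eq_neg_one (hj : j * j = -1) : ‖j‖ = 1 := by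
  rcases eq_I_or_eq_neg_I_of_mul_self_eq_neg_one hj with rfl | rfl <;> simp

theorem exp_mul_eq_cos_add_mul_sin (hj : j * j = -1) (θ : ℂ) :
    Complex.exp (j * θ) = Complex.cos θ + j * Complex.sin θ := by
  rcases eq_I_or_eq_neg_I_of_mul_self_eq_neg_one hj with rfl | rfl
  · rw [mul_comm, Complex.exp_mul_I, mul_comm Complex.I]
  · rw [neg_mul_comm, mul_comm, Complex.exp_mul_I, Complex.cos_neg, Complex.sin_neg]
    ring

theorem norm_exp_mul_le (hj : j * j = -1) (θ : ℂ) : ‖Complex.exp (j * θ)‖ ≤ Real.exp |θ.im| := by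
  rw [Complex.norm_exp, Real.exp_le_exp]
  rcases eq_I_or_eq_neg_I_of_mul_self_eq_neg_one hj with rfl | rfl
  · simpa using neg_le_abs θ.im
  · simpa using le_abs_self θ.im

/-- The matrix of the rotation by the (complex) angle `θ`. The solutions of the free equation
`J y' = lam y` are `x ↦ rotationMatrix (lam * x) *ᵥ v`. -/
def rotationMatrix (θ : ℂ) : Matrix (Fin 2) (Fin 2) ℂ :=
  !![Complex.cos θ, -Complex.sin θ; Complex.sin θ, Complex.cos θ]

theorem rotationMatrix_mulVec (θ : ℂ) (v : Fin 2 → ℂ) : rotationMatrix θ *ᵥ v =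
    ![Complex.cos θ * v 0 - Complex.sin θ * v 1, Complex.sin θ * v 0 + Complex.cos θ * v 1] := by
  ext i
  fin_cases i <;> simp [rotationMatrix, Matrix.mulVec, dotProduct, Fin.sum_univ_two, sub_eq_add_neg]

theorem rotationMatrix_mulVec_zero_add_mul_one (hj : j * j = -1) (θ : ℂ) (v : Fin 2 → ℂ) :
    (rotationMatrix θ *ᵥ v) 0 + j * (rotationMatrix θ *ᵥ v) 1
      = Complex.exp (j * θ) * (v 0 + j * v 1) := by
  rw [rotationMatrix_mulVec, exp_mul_eq_cos_add_mul_sin hj]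
  simp only [Matrix.cons_val_zero, Matrix.cons_val_one]
  linear_combination -Complex.sin θ * v 1 * hj

theorem rotationMatrix_mulVec_eigenvector (hj : j * j = -1) (θ : ℂ) :
    rotationMatrix θ *ᵥ ![1, -j] = Complex.exp (j * θ) • ![1, -j] := by
  rw [rotationMatrix_mulVec, exp_mul_eq_cos_add_mul_sin hj]
  ext i
  fin_cases i <;> simp only [Fin.zero_eta, Fin.mk_one, Matrix.cons_val_zero, Matrix.cons_val_one,
    Pi.smul_apply, smul_eq_mul]
  · ring
  · linear_combination Complex.sin θ * hj

theorem norm_le_of_forall_norm_add_mul_le {v : Fin 2 → ℂ} {r : ℝ}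
    (h : ∀ j : ℂ, j * j = -1 → ‖v 0 + j * v 1‖ ≤ r) : ‖v‖ ≤ r := by
  have hI := h Complex.I Complex.I_mul_I
  have hnegI := h (-Complex.I) (by rw [neg_mul_neg, Complex.I_mul_I])
  have hv0 : 2 * v 0 = (v 0 + Complex.I * v 1) + (v 0 + -Complex.I * v 1) := by ring
  have hv1 : 2 * Complex.I * v 1 = (v 0 + Complex.I * v 1) - (v 0 + -Complex.I * v 1) := by ring
  have hn0 := (congrArg norm hv0).trans_le (norm_add_le_of_le hI hnegI)
  have hn1 := (congrArg norm hv1).trans_le (norm_sub_le_of_le hI hnegI)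
  simp only [norm_mul, Complex.norm_ofNat, Complex.norm_I, mul_one] at hn0 hn1
  refine (pi_norm_le_iff_of_nonneg ((norm_nonneg _).trans hI)).2 <|
    Fin.forall_fin_two.2 ⟨by linarith, by linarith⟩

theorem norm_zero_add_mul_one_le (hj : j * j = -1) (v : Fin 2 → ℂ) :
    ‖v 0 + j * v 1‖ ≤ 2 * ‖v‖ := by
  rw [two_mul]
  refine norm_add_le_of_le (norm_le_pi_norm v 0) ?_
  rw [norm_mul, norm_eq_one_of_mul_self_eq_neg_one hj, one_mul]
  exact norm_le_pi_norm v 1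

theorem norm_rotationMatrix_mulVec_le (θ : ℂ) (v : Fin 2 → ℂ) :
    ‖rotationMatrix θ *ᵥ v‖ ≤ 2 * Real.exp |θ.im| * ‖v‖ := by
  refine norm_le_of_forall_norm_add_mul_le fun j hj => ?_
  rw [rotationMatrix_mulVec_zero_add_mul_one hj, norm_mul]
  calc _ ≤ Real.exp |θ.im| * (2 * ‖v‖) := by
        gcongr
        exacts [norm_exp_mul_le hj θ, norm_zero_add_mul_one_le hj v]
    _ = 2 * Real.exp |θ.im| * ‖v‖ := by ring

theorem norm_sub_rotationMatrix_mulVec_le {v w : Fin 2 → ℂ} {δ : ℝ} (h : ∀ j : ℂ, j * j = -1 →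
    ‖Complex.exp (-j * θ) * (v 0 + j * v 1) - (w 0 + j * w 1)‖ ≤ δ) :
    ‖v - rotationMatrix θ *ᵥ w‖ ≤ Real.exp |θ.im| * δ := by
  refine norm_le_of_forall_norm_add_mul_le fun j hj => ?_
  have hexp : Complex.exp (j * θ) * Complex.exp (-j * θ) = 1 := by
    rw [← Complex.exp_add, ← add_mul, add_neg_cancel, zero_mul, Complex.exp_zero]
  have heq : (v - rotationMatrix θ *ᵥ w) 0 + j * (v - rotationMatrix θ *ᵥ w) 1 = Complex.exp (j * θ)
      * (Complex.exp (-j * θ) * (v 0 + j * v 1) - (w 0 + j * w 1)) := by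
    simp only [Pi.sub_apply]
    linear_combination -rotationMatrix_mulVec_zero_add_mul_one hj θ w - (v 0 + j * v 1) * hexp
  rw [heq, norm_mul]
  gcongr
  exacts [norm_exp_mul_le hj θ, h j hj]

end Exponential

namespace Dirac

variable {p q : ℝ → ℂ} {lam j : ℂ} {y : ℝ → Fin 2 → ℂ}

/-- The amplitude `exp (-j lam x) (y₁ + j y₂)` of a solution `y` of the Dirac system, where
`j = ± i`. It is constant if `p = q = 0`. -/
def amplitude (j lam : ℂ) (y : ℝ → Fin 2 → ℂ) (x : ℝ) : ℂ :=
  Complex.exp (-j * (lam * x)) * (y x 0 + j * y x 1)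

/-- The coefficient in the equation `(amplitude j)' = coupling j * amplitude (-j)`, where
`j = ± i`. -/
def coupling (p q : ℝ → ℂ) (j lam : ℂ) (x : ℝ) : ℂ :=
  q x * Complex.exp (-j * (2 * lam) * x) + -j * (p x * Complex.exp (-j * (2 * lam) * x))

theorem hasDerivAt_amplitude (hj : j * j = -1) {x : ℝ}
    (hy : HasDerivAt y (generator p q lam x (y x)) x) : HasDerivAt (amplitude j lam y)
      (coupling p q j lam x * amplitude (-j) lam y x) x := by
  have hexp : HasDerivAt (fun u : ℝ => Complex.exp (-j * (lam * u)))
      (Complex.exp (-j * (lam * x)) * (-j * (lam * 1))) x :=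
    (((Complex.ofRealCLM.hasDerivAt (x := x)).const_mul lam).const_mul (-j)).cexp
  have hy := hasDerivAt_pi.1 hy
  refine (hexp.fun_mul ((hy 0).fun_add ((hy 1).const_mul j))).congr_deriv ?_
  have hmul : Complex.exp (-j * (2 * lam) * x) * Complex.exp (- -j * (lam * x))
      = Complex.exp (-j * (lam * x)) := by
    rw [← Complex.exp_add]
    congr 1
    ring
  simp only [coupling, amplitude, generator_apply, Matrix.cons_val_zero, Matrix.cons_val_one]
  linear_combination -Complex.exp (-j * (lam * x)) * (lam + p x) * y x 1 * hj
    - (q x + -j * p x) * (y x 0 + -j * y x 1) * hmul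

theorem absolutelyContinuousOnInterval_amplitude {a b : ℝ}
    (hy : AbsolutelyContinuousOnInterval y a b) :
    AbsolutelyContinuousOnInterval (amplitude j lam y) a b := by
  have hexp : ContDiff ℝ 1 fun u : ℝ => Complex.exp (-j * (lam * u)) :=
    (contDiff_const.mul (contDiff_const.mul Complex.ofRealCLM.contDiff)).cexp
  exact hexp.contDiffOn.absolutelyContinuousOnInterval.fun_smul
    ((absolutelyContinuousOnInterval_apply hy 0).fun_add
      ((absolutelyContinuousOnInterval_apply hy 1).const_smul j))

theorem IsSolution.isCoupledSolution_amplitude (hy : IsSolution p q lam y) (hj : j * j = -1) :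
    IsCoupledSolution (coupling p q j lam) (coupling p q (-j) lam) (amplitude j lam y)
      (amplitude (-j) lam y) 0 π := by
  obtain ⟨hac, hderiv⟩ := isSolution_iff.1 hy
  refine ⟨absolutelyContinuousOnInterval_amplitude hac,
    absolutelyContinuousOnInterval_amplitude hac, ?_, ?_⟩
  · filter_upwards [hderiv] with x hx hm
    exact hasDerivAt_amplitude hj (hx hm)
  · filter_upwards [hderiv] with x hx hm
    simpa only [neg_neg] using hasDerivAt_amplitude (j := -j) (by rwa [neg_mul_neg]) (hx hm)

theorem amplitude_zero (j lam : ℂ) (y : ℝ → Fin 2 → ℂ) :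
    amplitude j lam y 0 = y 0 0 + j * y 0 1 := by
  simp [amplitude]

theorem exists_isOscillating_coupling (hp : BoundedVariationOn p (Icc 0 π))
    (hq : BoundedVariationOn q (Icc 0 π)) (R : ℝ) :
    ∃ M C, 0 ≤ M ∧ 0 ≤ C ∧ ∀ j lam : ℂ, j * j = -1 → |lam.im| ≤ R → lam ≠ 0 →
      IsOscillating (coupling p q j lam) 0 π M (C / ‖lam‖) := by
  obtain ⟨Mp, Cp, hMp, hCp, hp⟩ :=
    exists_isOscillating_mul_exp Real.pi_nonneg hp (Real.exp (2 * R * π))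
  obtain ⟨Mq, Cq, hMq, hCq, hq⟩ :=
    exists_isOscillating_mul_exp Real.pi_nonneg hq (Real.exp (2 * R * π))
  refine ⟨Mq + Mp, (Cq + Cp) / 2, by positivity, by positivity, fun j lam hj hR hlam => ?_⟩
  have hj1 : ‖j‖ = 1 := norm_eq_one_of_mul_self_eq_neg_one hj
  have hnorm : ‖-j * (2 * lam)‖ = 2 * ‖lam‖ := by
    rw [norm_mul, norm_neg, hj1, one_mul, norm_mul, Complex.norm_ofNat]
  have hκ : -j * (2 * lam) ≠ 0 := by
    rw [← norm_ne_zero_iff, hnorm]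
    positivity
  have hexp : ∀ u ∈ Icc 0 π, ‖Complex.exp (-j * (2 * lam) * u)‖ ≤ Real.exp (2 * R * π) := by
    intro u hu
    rw [mul_assoc]
    refine (norm_exp_mul_le (by rwa [neg_mul_neg]) _).trans (Real.exp_le_exp.2 ?_)
    have him : (2 * lam * u).im = 2 * (lam.im * u) := by simp [mul_assoc]
    rw [him, abs_mul, abs_two, abs_mul, abs_of_nonneg hu.1, mul_assoc]
    exact mul_le_mul_of_nonneg_left
      (mul_le_mul hR hu.2 hu.1 ((abs_nonneg _).trans hR)) zero_le_two
  have hosc := (hq _ hκ hexp).add ((hp _ hκ hexp).const_mul (-j))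
  rw [norm_neg, hj1, one_mul, one_mul, hnorm, ← add_div, ← div_div] at hosc
  exact hosc

theorem exists_norm_amplitude_sub_le (hp : BoundedVariationOn p (Icc 0 π))
    (hq : BoundedVariationOn q (Icc 0 π)) (R : ℝ) :
    ∃ K Λ : ℝ, 0 ≤ K ∧ 0 < Λ ∧ ∀ lam : ℂ, |lam.im| ≤ R → Λ ≤ ‖lam‖ →
      ∀ y, IsSolution p q lam y → ∀ j : ℂ, j * j = -1 → ∀ x ∈ Icc 0 π,
        ‖amplitude j lam y x - amplitude j lam y 0‖ ≤ K / ‖lam‖ * ‖y 0‖ := by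
  obtain ⟨M, C, hM, hC, hosc⟩ := exists_isOscillating_coupling hp hq R
  set K := C * (1 + (π - 0) * M) with hK
  have hπ := Real.pi_pos
  have hK0 : 0 ≤ K := by simp only [hK, sub_zero]; positivity
  refine ⟨4 * K, 2 * K + 1, by positivity, by positivity, fun lam hR hΛ y hy j hj x hx => ?_⟩
  have hpos : 0 < ‖lam‖ := by linarith
  have hlam : lam ≠ 0 := norm_pos_iff.1 hpos
  have hj' : -j * -j = -1 := by rwa [neg_mul_neg]
  have hsmall : C / ‖lam‖ * (1 + (π - 0) * M) = K / ‖lam‖ := div_mul_eq_mul_div _ _ _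
  have hhalf : C / ‖lam‖ * (1 + (π - 0) * M) ≤ 1 / 2 := by
    rw [hsmall, div_le_div_iff₀ hpos two_pos]
    linarith
  have hmax : max ‖amplitude j lam y 0‖ ‖amplitude (-j) lam y 0‖ ≤ 2 * ‖y 0‖ := by
    rw [amplitude_zero, amplitude_zero]
    exact max_le (norm_zero_add_mul_one_le hj _) (norm_zero_add_mul_one_le hj' _)
  have hle := (hy.isCoupledSolution_amplitude hj).norm_sub_le_of_le_half (hosc j lam hj hR hlam)
    (hosc (-j) lam hj' hR hlam) hhalf hx
  rw [hsmall] at hle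
  calc _ ≤ 2 * (K / ‖lam‖) * (2 * ‖y 0‖) := hle.trans (by gcongr)
    _ = 4 * K / ‖lam‖ * ‖y 0‖ := by ring

theorem abs_im_mul_ofReal_le {R : ℝ} (hR : |lam.im| ≤ R) {x : ℝ} (hx : x ∈ Icc 0 π) :
    |(lam * x).im| ≤ R * π := by
  rw [Complex.im_mul_ofReal, abs_mul, abs_of_nonneg hx.1]
  exact mul_le_mul hR hx.2 hx.1 ((abs_nonneg _).trans hR)

theorem exists_norm_sub_rotationMatrix_mulVec_le (hp : BoundedVariationOn p (Icc 0 π))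
    (hq : BoundedVariationOn q (Icc 0 π)) (R : ℝ) :
    ∃ K Λ : ℝ, 0 ≤ K ∧ 0 < Λ ∧ ∀ lam : ℂ, |lam.im| ≤ R → Λ ≤ ‖lam‖ →
      ∀ y, IsSolution p q lam y → ∀ x ∈ Icc 0 π,
        ‖y x - rotationMatrix (lam * x) *ᵥ y 0‖ ≤ K / ‖lam‖ * ‖y 0‖ := by
  obtain ⟨K, Λ, hK, hΛ, hamp⟩ := exists_norm_amplitude_sub_le hp hq R
  refine ⟨Real.exp (R * π) * K, Λ, by positivity, hΛ, fun lam hR hlam y hy x hx => ?_⟩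
  have hpos : 0 < ‖lam‖ := hΛ.trans_le hlam
  have hrot := norm_sub_rotationMatrix_mulVec_le (θ := lam * x) (v := y x) fun j hj => by
    rw [← amplitude_zero j lam y]
    exact hamp lam hR hlam y hy j hj x hx
  calc _ ≤ Real.exp |(lam * x).im| * (K / ‖lam‖ * ‖y 0‖) := hrot
    _ ≤ Real.exp (R * π) * (K / ‖lam‖ * ‖y 0‖) := by
      gcongr
      exact abs_im_mul_ofReal_le hR hx
    _ = Real.exp (R * π) * K / ‖lam‖ * ‖y 0‖ := by ring

end Dirac

end FreeAsymptotics

section Perturbation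

theorem eventually_cofinite_int_iff {P : ℤ → Prop} :
    (∀ᶠ n in cofinite, P n) ↔ ∃ N : ℕ, ∀ n : ℤ, (N : ℤ) < |n| → P n := by
  rw [eventually_cofinite]
  constructor
  · intro hfin
    obtain ⟨N, hN⟩ := (hfin.image Int.natAbs).bddAbove
    refine ⟨N, fun n hn => by_contra fun hnP => ?_⟩
    rw [Int.abs_eq_natAbs, Nat.cast_lt] at hn
    exact hn.not_ge (hN (mem_image_of_mem Int.natAbs hnP))
  · rintro ⟨N, hN⟩
    refine (finite_Icc (-(N : ℤ)) N).subset fun n hn => abs_le.1 ?_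
    exact not_lt.1 fun hlt => hn (hN n hlt)

theorem eventually_cofinite_le_abs_int (C : ℝ) : ∀ᶠ n : ℤ in cofinite, C ≤ |(n : ℝ)| := by
  obtain ⟨N, hN⟩ := exists_nat_ge C
  refine eventually_cofinite_int_iff.2 ⟨N, fun n hn => hN.trans ?_⟩
  exact_mod_cast hn.le

theorem eventually_cofinite_div_abs_int_le (C : ℝ) {ε : ℝ} (hε : 0 < ε) :
    ∀ᶠ n : ℤ in cofinite, C / |(n : ℝ)| ≤ ε := by
  filter_upwards [eventually_cofinite_le_abs_int (C / ε), eventually_cofinite_le_abs_int 1]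
    with n hn hn1
  rwa [div_le_iff₀ (by linarith), ← div_le_iff₀' hε]

theorem norm_exp_mul_sub_exp_mul_le {j θ η : ℂ} {R : ℝ} (hj : j * j = -1) (hθ : |θ.im| ≤ R)
    (hη : |η.im| ≤ R) :
    ‖Complex.exp (j * θ) - Complex.exp (j * η)‖ ≤ Real.exp R * ‖θ - η‖ := by
  have hconvex : Convex ℝ {z : ℂ | |z.im| ≤ R} := by
    simp only [abs_le]
    exact (convex_Icc (-R) R).linear_preimage Complex.imLm
  refine hconvex.norm_image_sub_le_of_norm_hasDerivWithin_le
    (f := fun z => Complex.exp (j * z)) (f' := fun z => Complex.exp (j * z) * (j * 1))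
    (fun z _ => ((hasDerivAt_id z).const_mul j).cexp.hasDerivWithinAt) (fun z hz => ?_) hη hθ
  rw [mul_one, norm_mul, norm_eq_one_of_mul_self_eq_neg_one hj, mul_one]
  exact (norm_exp_mul_le hj z).trans (Real.exp_le_exp.2 hz)

theorem norm_rotationMatrix_mulVec_sub_le {θ η : ℂ} {R : ℝ} (hθ : |θ.im| ≤ R) (hη : |η.im| ≤ R)
    (v : Fin 2 → ℂ) :
    ‖rotationMatrix θ *ᵥ v - rotationMatrix η *ᵥ v‖ ≤ 2 * Real.exp R * ‖θ - η‖ * ‖v‖ := by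
  refine norm_le_of_forall_norm_add_mul_le fun j hj => ?_
  have heq : (rotationMatrix θ *ᵥ v - rotationMatrix η *ᵥ v) 0
      + j * (rotationMatrix θ *ᵥ v - rotationMatrix η *ᵥ v) 1
      = (Complex.exp (j * θ) - Complex.exp (j * η)) * (v 0 + j * v 1) := by
    simp only [Pi.sub_apply]
    linear_combination rotationMatrix_mulVec_zero_add_mul_one hj θ v
      - rotationMatrix_mulVec_zero_add_mul_one hj η v
  rw [heq, norm_mul]
  calc _ ≤ Real.exp R * ‖θ - η‖ * (2 * ‖v‖) := by
        gcongr
        exacts [norm_exp_mul_sub_exp_mul_le hj hθ hη, norm_zero_add_mul_one_le hj v]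
    _ = 2 * Real.exp R * ‖θ - η‖ * ‖v‖ := by ring

theorem norm_sin_sub_sin_le {θ η : ℂ} {R : ℝ} (hθ : |θ.im| ≤ R) (hη : |η.im| ≤ R) :
    ‖Complex.sin θ - Complex.sin η‖ ≤ 2 * Real.exp R * ‖θ - η‖ := by
  have hrot := norm_rotationMatrix_mulVec_sub_le hθ hη ![1, 0]
  have hone : ‖(![1, 0] : Fin 2 → ℂ)‖ = 1 := by
    simp [Pi.norm_def, Fin.univ_succ]
  rw [hone, mul_one] at hrot
  simpa only [rotationMatrix_mulVec, Pi.sub_apply, Matrix.cons_val_zero, Matrix.cons_val_one,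
    mul_one, mul_zero, add_zero] using (norm_le_pi_norm _ 1).trans hrot

theorem exists_mem_closedBall_eq_of_norm_deriv_sub_le {𝕜 : Type*} [RCLike 𝕜] {f : 𝕜 → 𝕜}
    {a z₀ w : 𝕜} {r : ℝ} (ha : a ≠ 0) (hr : 0 ≤ r)
    (hf : ∀ z ∈ Metric.closedBall z₀ r, DifferentiableAt 𝕜 f z)
    (hderiv : ∀ z ∈ Metric.closedBall z₀ r, ‖deriv f z - a‖ ≤ ‖a‖ / 2)
    (hw : ‖w - f z₀‖ ≤ ‖a‖ / 2 * r) : ∃ z ∈ Metric.closedBall z₀ r, f z = w := by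
  have happrox : ApproximatesLinearOn f (ContinuousLinearMap.mul 𝕜 𝕜 a) (Metric.closedBall z₀ r)
      (‖a‖₊ / 2) := fun x hx y hy => by
    have hle := (convex_closedBall z₀ r).norm_image_sub_le_of_norm_hasDerivWithin_le
      (fun z hz => ((hf z hz).hasDerivAt.fun_sub
        ((hasDerivAt_id z).const_mul a)).hasDerivWithinAt)
      (fun z hz => by simpa only [mul_one] using hderiv z hz) hy hx
    have heq : f x - f y - a * (x - y) = f x - a * x - (f y - a * y) := by ring
    rw [ContinuousLinearMap.mul_apply', heq]
    exact hle
  let inverse : (ContinuousLinearMap.mul 𝕜 𝕜 a).NonlinearRightInverse :=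
    { toFun := fun z => a⁻¹ * z
      nnnorm := ‖a‖₊⁻¹
      bound' := fun z => by simp
      right_inv' := fun z => by simp [ha] }
  have hradius : ((inverse.nnnorm : ℝ)⁻¹ - (‖a‖₊ / 2 : NNReal)) * r = ‖a‖ / 2 * r := by
    simp [inverse, sub_half]
  obtain ⟨z, hz, hzw⟩ := happrox.surjOn_closedBall_of_nonlinearRightInverse inverse hr subset_rfl
    (mem_closedBall_iff_norm.2 (hw.trans_eq hradius.symm))
  exact ⟨z, hz, hzw⟩

end Perturbation

noncomputable section Monodromy

namespace Dirac

variable {p q : ℝ → ℂ} {lam t σ z : ℂ} {T : ℝ} {n : ℤ}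

/-- The eigenvalues `2n ± t` of `L_t(0)`, where `σ = ± 1`. -/
def freeEigenvalue (σ : ℂ) (n : ℤ) (t : ℂ) : ℂ := 2 * n + σ * t

theorem norm_eq_one_of_eq_one_or_neg_one (hσ : σ = 1 ∨ σ = -1) : ‖σ‖ = 1 := by
  rcases hσ with rfl | rfl <;> simp

theorem freeEigenvalue_mul_pi (σ : ℂ) (n : ℤ) (t : ℂ) :
    freeEigenvalue σ n t * π = σ * (t * π) + n * (2 * π) := by
  rw [freeEigenvalue]
  ring

theorem cos_freeEigenvalue_mul_pi (hσ : σ = 1 ∨ σ = -1) (n : ℤ) (t : ℂ) :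
    Complex.cos (freeEigenvalue σ n t * π) = Complex.cos (t * π) := by
  rw [freeEigenvalue_mul_pi, Complex.cos_add_int_mul_two_pi]
  rcases hσ with rfl | rfl
  · rw [one_mul]
  · rw [neg_one_mul, Complex.cos_neg]

theorem sin_freeEigenvalue_mul_pi (hσ : σ = 1 ∨ σ = -1) (n : ℤ) (t : ℂ) :
    Complex.sin (freeEigenvalue σ n t * π) = σ * Complex.sin (t * π) := by
  rw [freeEigenvalue_mul_pi, Complex.sin_add_int_mul_two_pi]
  rcases hσ with rfl | rfl
  · rw [one_mul, one_mul]
  · rw [neg_one_mul, neg_one_mul, Complex.sin_neg]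

theorem norm_sub_two_mul_le (hσ : ‖σ‖ = 1) (ht : ‖t‖ ≤ T)
    (hz : ‖z - freeEigenvalue σ n t‖ ≤ 1) : ‖z - 2 * n‖ ≤ T + 1 := by
  have heq : z - 2 * n = σ * t + (z - freeEigenvalue σ n t) := by
    rw [freeEigenvalue]
    ring
  rw [heq]
  refine norm_add_le_of_le ?_ hz
  rwa [norm_mul, hσ, one_mul]

theorem abs_im_le_of_norm_sub_freeEigenvalue_le (hσ : ‖σ‖ = 1) (ht : ‖t‖ ≤ T)
    (hz : ‖z - freeEigenvalue σ n t‖ ≤ 1) : |z.im| ≤ T + 1 := by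
  have him : z.im = (z - 2 * n).im := by simp
  rw [him]
  exact (Complex.abs_im_le_norm _).trans (norm_sub_two_mul_le hσ ht hz)

theorem abs_int_le_norm_of_norm_sub_freeEigenvalue_le (hσ : ‖σ‖ = 1) (ht : ‖t‖ ≤ T)
    (hz : ‖z - freeEigenvalue σ n t‖ ≤ 1) (hn : T + 1 ≤ |(n : ℝ)|) : |(n : ℝ)| ≤ ‖z‖ := by
  have htwo : ‖(2 * n : ℂ)‖ = 2 * |(n : ℝ)| := by
    rw [norm_mul, Complex.norm_ofNat, Complex.norm_intCast]
  have hsub := norm_sub_norm_le (2 * n : ℂ) (2 * n - z)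
  rw [sub_sub_cancel, norm_sub_rev (2 * n : ℂ) z] at hsub
  linarith [norm_sub_two_mul_le hσ ht hz]

theorem exists_eventually_norm_sub_rotationMatrix_mulVec_le (hp : BoundedVariationOn p (Icc 0 π))
    (hq : BoundedVariationOn q (Icc 0 π)) (hσ : ‖σ‖ = 1) (T : ℝ) :
    ∃ K, 0 ≤ K ∧ ∀ᶠ n : ℤ in cofinite, ∀ t : ℂ, ‖t‖ ≤ T → ∀ z,
      ‖z - freeEigenvalue σ n t‖ ≤ 1 → ∀ y, IsSolution p q z y → ∀ x ∈ Icc 0 π,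
        ‖y x - rotationMatrix (z * x) *ᵥ y 0‖ ≤ K / |(n : ℝ)| * ‖y 0‖ := by
  obtain ⟨K, Λ, hK, hΛ, hrot⟩ := exists_norm_sub_rotationMatrix_mulVec_le hp hq (T + 1)
  refine ⟨K, hK, ?_⟩
  filter_upwards [eventually_cofinite_le_abs_int Λ, eventually_cofinite_le_abs_int (T + 1)]
    with n hnΛ hnT t ht z hz y hy x hx
  have him := abs_im_le_of_norm_sub_freeEigenvalue_le hσ ht hz
  have hnz := abs_int_le_norm_of_norm_sub_freeEigenvalue_le hσ ht hz hnT
  have hpos : 0 < |(n : ℝ)| := hΛ.trans_le hnΛ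
  refine (hrot z him (hnΛ.trans hnz) y hy x hx).trans ?_
  gcongr

theorem exists_eventually_norm_sub_rotationMatrix_freeEigenvalue_mulVec_le
    (hp : BoundedVariationOn p (Icc 0 π)) (hq : BoundedVariationOn q (Icc 0 π)) (hσ : ‖σ‖ = 1)
    (T C : ℝ) : ∃ K, 0 ≤ K ∧ ∀ᶠ n : ℤ in cofinite, ∀ t : ℂ, ‖t‖ ≤ T → ∀ z,
      ‖z - freeEigenvalue σ n t‖ ≤ C / |(n : ℝ)| → ∀ y, IsSolution p q z y → ∀ x ∈ Icc 0 π,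
        ‖y x - rotationMatrix (freeEigenvalue σ n t * x) *ᵥ y 0‖ ≤ K / |(n : ℝ)| * ‖y 0‖ := by
  obtain ⟨K, hK, hrot⟩ := exists_eventually_norm_sub_rotationMatrix_mulVec_le hp hq hσ T
  set E := 2 * Real.exp ((T + 1) * π)
  refine ⟨K + E * (|C| * π), by positivity, ?_⟩
  filter_upwards [hrot, eventually_cofinite_div_abs_int_le C one_pos]
    with n hn hC t ht z hz y hy x hx
  have him := abs_im_mul_ofReal_le (abs_im_le_of_norm_sub_freeEigenvalue_le hσ ht
    (hz.trans hC)) hx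
  have him₀ := abs_im_mul_ofReal_le (abs_im_le_of_norm_sub_freeEigenvalue_le (n := n) hσ ht
    (by rw [sub_self, norm_zero]; exact zero_le_one)) hx
  have hdist : ‖z * x - freeEigenvalue σ n t * x‖ ≤ |C| / |(n : ℝ)| * π := by
    rw [← sub_mul, norm_mul, Complex.norm_real, Real.norm_of_nonneg hx.1]
    exact mul_le_mul (hz.trans (by gcongr; exact le_abs_self C)) hx.2 hx.1 (by positivity)
  rw [← sub_add_sub_cancel]
  calc _ ≤ K / |(n : ℝ)| * ‖y 0‖ + E * (|C| / |(n : ℝ)| * π) * ‖y 0‖ :=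
        norm_add_le_of_le (hn t ht z (hz.trans hC) y hy x hx)
          ((norm_rotationMatrix_mulVec_sub_le him him₀ (y 0)).trans (by gcongr))
    _ = (K + E * (|C| * π)) / |(n : ℝ)| * ‖y 0‖ := by ring

section FundamentalSolutions

variable (hp : BoundedVariationOn p (Icc 0 π)) (hq : BoundedVariationOn q (Icc 0 π))
include hp hq

theorem isSolution_c (lam : ℂ) : IsSolution p q lam (c p q lam) :=
  (isSolution_solution hp hq lam _).1

theorem c_zero (lam : ℂ) : c p q lam 0 = ![1, 0] := (isSolution_solution hp hq lam _).2

theorem isSolution_s (lam : ℂ) : IsSolution p q lam (s p q lam) :=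
  (isSolution_solution hp hq lam _).1

theorem s_zero (lam : ℂ) : s p q lam 0 = ![0, 1] := (isSolution_solution hp hq lam _).2

theorem differentiable_F : Differentiable ℂ (F p q) :=
  (differentiable_solution hp hq ![1, 0] (right_mem_Icc.2 Real.pi_nonneg) 0).add
    (differentiable_solution hp hq ![0, 1] (right_mem_Icc.2 Real.pi_nonneg) 1)

variable {w : ℂ} {δ : ℝ} (h : ∀ y, IsSolution p q lam y →
    ‖y π - rotationMatrix w *ᵥ y 0‖ ≤ δ * ‖y 0‖)
include h

theorem norm_c_pi_sub_le : ‖c p q lam π - ![Complex.cos w, Complex.sin w]‖ ≤ δ := by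
  have hone : ‖(![1, 0] : Fin 2 → ℂ)‖ = 1 := by simp [Pi.norm_def, Fin.univ_succ]
  simpa only [c_zero hp hq, hone, rotationMatrix_mulVec, Matrix.cons_val_zero, Matrix.cons_val_one,
    mul_one, mul_zero, add_zero, sub_zero] using h _ (isSolution_c hp hq lam)

theorem norm_s_pi_sub_le : ‖s p q lam π - ![-Complex.sin w, Complex.cos w]‖ ≤ δ := by
  have hone : ‖(![0, 1] : Fin 2 → ℂ)‖ = 1 := by simp [Pi.norm_def, Fin.univ_succ]
  simpa only [s_zero hp hq, hone, rotationMatrix_mulVec, Matrix.cons_val_zero, Matrix.cons_val_one,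
    mul_one, mul_zero, zero_add, zero_sub] using h _ (isSolution_s hp hq lam)

theorem norm_F_sub_le : ‖F p q lam - 2 * Complex.cos w‖ ≤ 2 * δ := by
  have heq : F p q lam - 2 * Complex.cos w
      = (c p q lam π - ![Complex.cos w, Complex.sin w]) 0
        + (s p q lam π - ![-Complex.sin w, Complex.cos w]) 1 := by
    simp only [F, Pi.sub_apply, Matrix.cons_val_zero, Matrix.cons_val_one]
    ring
  rw [heq, two_mul]
  exact norm_add_le_of_le ((norm_le_pi_norm _ 0).trans (norm_c_pi_sub_le hp hq h))
    ((norm_le_pi_norm _ 1).trans (norm_s_pi_sub_le hp hq h))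

end FundamentalSolutions

theorem exists_eventually_norm_monodromy_sub_le (hp : BoundedVariationOn p (Icc 0 π))
    (hq : BoundedVariationOn q (Icc 0 π)) (hσ : σ = 1 ∨ σ = -1) (T C : ℝ) :
    ∃ K, 0 ≤ K ∧ ∀ᶠ n : ℤ in cofinite, ∀ t : ℂ, ‖t‖ ≤ T → ∀ z,
      ‖z - freeEigenvalue σ n t‖ ≤ C / |(n : ℝ)| →
        ‖c p q z π 0 - Complex.cos (t * π)‖ ≤ K / |(n : ℝ)| ∧
        ‖s p q z π 0 + σ * Complex.sin (t * π)‖ ≤ K / |(n : ℝ)| := by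
  obtain ⟨K, hK, hrot⟩ := exists_eventually_norm_sub_rotationMatrix_freeEigenvalue_mulVec_le hp hq
    (norm_eq_one_of_eq_one_or_neg_one hσ) T C
  refine ⟨K, hK, hrot.mono fun n hn t ht z hz => ?_⟩
  have hclose := fun y hy => hn t ht z hz y hy π (right_mem_Icc.2 Real.pi_nonneg)
  have hc := (norm_le_pi_norm _ 0).trans (norm_c_pi_sub_le hp hq hclose)
  have hs := (norm_le_pi_norm _ 0).trans (norm_s_pi_sub_le hp hq hclose)
  simp only [Pi.sub_apply, Matrix.cons_val_zero, cos_freeEigenvalue_mul_pi hσ,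
    sin_freeEigenvalue_mul_pi hσ, sub_neg_eq_add] at hc hs
  exact ⟨hc, hs⟩

theorem exists_eventually_norm_F_sub_le (hp : BoundedVariationOn p (Icc 0 π))
    (hq : BoundedVariationOn q (Icc 0 π)) (hσ : ‖σ‖ = 1) (T : ℝ) :
    ∃ K : ℝ, ∀ᶠ n : ℤ in cofinite, ∀ t : ℂ, ‖t‖ ≤ T → ∀ z,
      ‖z - freeEigenvalue σ n t‖ ≤ 1 →
        ‖F p q z - 2 * Complex.cos (z * π)‖ ≤ K / |(n : ℝ)| := by
  obtain ⟨K, -, hrot⟩ := exists_eventually_norm_sub_rotationMatrix_mulVec_le hp hq hσ T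
  refine ⟨2 * K, hrot.mono fun n hn t ht z hz => ?_⟩
  rw [mul_div_assoc]
  exact norm_F_sub_le hp hq fun y hy => hn t ht z hz y hy π (right_mem_Icc.2 Real.pi_nonneg)

theorem hasDerivAt_two_mul_cos_mul_pi (z : ℂ) :
    HasDerivAt (fun z : ℂ => 2 * Complex.cos (z * π)) (-(2 * π * Complex.sin (z * π))) z :=
  (((hasDerivAt_id z).mul_const (π : ℂ)).ccos.const_mul 2).congr_deriv (by simp only [id]; ring)

theorem exists_eventually_norm_deriv_F_add_sin_le (hp : BoundedVariationOn p (Icc 0 π))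
    (hq : BoundedVariationOn q (Icc 0 π)) (hσ : ‖σ‖ = 1) (T : ℝ) :
    ∃ K : ℝ, ∀ᶠ n : ℤ in cofinite, ∀ t : ℂ, ‖t‖ ≤ T → ∀ z,
      ‖z - freeEigenvalue σ n t‖ ≤ 1 / 2 →
        ‖deriv (F p q) z + 2 * π * Complex.sin (z * π)‖ ≤ K / |(n : ℝ)| := by
  obtain ⟨K, hF⟩ := exists_eventually_norm_F_sub_le hp hq hσ T
  refine ⟨2 * K, hF.mono fun n hn t ht z hz => ?_⟩
  have hdiff : ∀ u, HasDerivAt (fun u => F p q u - 2 * Complex.cos (u * π))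
      (deriv (F p q) u + 2 * π * Complex.sin (u * π)) u := fun u =>
    ((differentiable_F hp hq u).hasDerivAt.fun_sub (hasDerivAt_two_mul_cos_mul_pi u)).congr_deriv
      (sub_neg_eq_add _ _)
  have hcauchy := Complex.norm_deriv_le_of_forall_mem_sphere_norm_le (c := z) one_half_pos
    (Differentiable.diffContOnCl fun u => (hdiff u).differentiableAt) fun u hu => hn t ht u (by
      rw [← sub_add_sub_cancel]
      exact (norm_add_le_of_le (mem_sphere_iff_norm.1 hu).le hz).trans_eq (add_halves 1))
  rw [(hdiff z).deriv] at hcauchy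
  exact hcauchy.trans_eq (by ring)

theorem norm_sin_mul_pi_sub_le (hσ : σ = 1 ∨ σ = -1) (ht : ‖t‖ ≤ T)
    (hz : ‖z - freeEigenvalue σ n t‖ ≤ 1) : ‖σ * Complex.sin (t * π) - Complex.sin (z * π)‖
      ≤ 2 * Real.exp ((T + 1) * π) * (‖z - freeEigenvalue σ n t‖ * π) := by
  have hσ1 := norm_eq_one_of_eq_one_or_neg_one hσ
  have hπ : π ∈ Icc 0 π := right_mem_Icc.2 Real.pi_nonneg
  have him := abs_im_mul_ofReal_le (abs_im_le_of_norm_sub_freeEigenvalue_le hσ1 ht hz) hπ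
  have him₀ := abs_im_mul_ofReal_le (abs_im_le_of_norm_sub_freeEigenvalue_le (n := n) hσ1 ht
    (by rw [sub_self, norm_zero]; exact zero_le_one)) hπ
  have hsin := norm_sin_sub_sin_le him₀ him
  rwa [sin_freeEigenvalue_mul_pi hσ, ← sub_mul, norm_mul, norm_sub_rev (freeEigenvalue _ _ _),
    Complex.norm_real, Real.norm_of_nonneg Real.pi_nonneg] at hsin

theorem exists_eventually_norm_deriv_F_add_le (hp : BoundedVariationOn p (Icc 0 π))
    (hq : BoundedVariationOn q (Icc 0 π)) (hσ : σ = 1 ∨ σ = -1) (T : ℝ) {ε : ℝ} (hε : 0 < ε) :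
    ∃ r, 0 < r ∧ ∀ᶠ n : ℤ in cofinite, ∀ t : ℂ, ‖t‖ ≤ T → ∀ z,
      ‖z - freeEigenvalue σ n t‖ ≤ r →
        ‖deriv (F p q) z + 2 * π * (σ * Complex.sin (t * π))‖ ≤ ε := by
  have hσ1 := norm_eq_one_of_eq_one_or_neg_one hσ
  obtain ⟨K, hF⟩ := exists_eventually_norm_deriv_F_add_sin_le hp hq hσ1 T
  set E := 2 * Real.exp ((T + 1) * π)
  have hE : 0 < 2 * π * (E * π) := by positivity
  refine ⟨min (1 / 2) (ε / 2 / (2 * π * (E * π))), by positivity, ?_⟩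
  filter_upwards [hF, eventually_cofinite_div_abs_int_le K (half_pos hε)] with n hn hKn t ht z hz
  have hz1 := hz.trans (min_le_left _ _)
  have hsin := norm_sin_mul_pi_sub_le hσ ht (hz1.trans one_half_lt_one.le)
  have hsplit : deriv (F p q) z + 2 * π * (σ * Complex.sin (t * π))
      = (deriv (F p q) z + 2 * π * Complex.sin (z * π))
        + 2 * π * (σ * Complex.sin (t * π) - Complex.sin (z * π)) := by ring
  rw [hsplit, ← add_halves ε]
  refine norm_add_le_of_le ((hn t ht z hz1).trans hKn) ?_
  rw [norm_mul, norm_mul, Complex.norm_ofNat, Complex.norm_real,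
    Real.norm_of_nonneg Real.pi_nonneg]
  calc _ ≤ 2 * π * (E * (‖z - freeEigenvalue σ n t‖ * π)) := by gcongr
    _ = 2 * π * (E * π) * ‖z - freeEigenvalue σ n t‖ := by ring
    _ ≤ ε / 2 := (le_div_iff₀' hE).1 (hz.trans (min_le_right _ _))

end Dirac

end Monodromy

section Eigenvalues

namespace Dirac

variable {p q : ℝ → ℂ} {lam t : ℂ}

theorem exp_sq_sub_mul_add_one_eq_zero_iff (t w : ℂ) :
    Complex.exp (Complex.I * π * t) ^ 2 - Complex.exp (Complex.I * π * t) * w + 1 = 0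
      ↔ w = 2 * Complex.cos (t * π) := by
  have hcos : 2 * Complex.cos (t * π)
      = Complex.exp (Complex.I * π * t) + (Complex.exp (Complex.I * π * t))⁻¹ := by
    rw [Complex.two_cos, ← Complex.exp_neg]
    congr 2 <;> ring
  have hne := Complex.exp_ne_zero (Complex.I * π * t)
  rw [hcos]
  field_simp
  constructor <;> intro h <;> linear_combination -h

variable (hp : BoundedVariationOn p (Icc 0 π)) (hq : BoundedVariationOn q (Icc 0 π))
include hp hq

theorem c_mul_s_sub (lam : ℂ) :
    c p q lam π 0 * s p q lam π 1 - c p q lam π 1 * s p q lam π 0 = 1 := by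
  rw [(isSolution_c hp hq lam).wronskian_eq (isSolution_s hp hq lam)
    (right_mem_Icc.2 Real.pi_nonneg), c_zero hp hq, s_zero hp hq]
  simp

theorem IsSolution.eqOn_smul_c_add_smul_s {y : ℝ → Fin 2 → ℂ} (hy : IsSolution p q lam y) :
    EqOn y (y 0 0 • c p q lam + y 0 1 • s p q lam) (Icc 0 π) := by
  refine hy.eqOn hp hq
    (((isSolution_c hp hq lam).const_smul _).add ((isSolution_s hp hq lam).const_smul _)) ?_
  ext i
  fin_cases i <;> simp [c_zero hp hq, s_zero hp hq]

theorem IsEigenvalue.F_eq (hlam : IsEigenvalue p q t lam) :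
    F p q lam = 2 * Complex.cos (t * π) := by
  obtain ⟨y, hy, hboundary, x, hx, hne⟩ := hlam
  have hcomb := hy.eqOn_smul_c_add_smul_s hp hq
  have hmonodromy := hcomb (right_mem_Icc.2 Real.pi_nonneg)
  rw [hboundary] at hmonodromy
  have hzero := congrFun hmonodromy 0
  have hone := congrFun hmonodromy 1
  simp only [Pi.smul_apply, Pi.add_apply, smul_eq_mul] at hzero hone
  have hdet := c_mul_s_sub hp hq lam
  rw [← exp_sq_sub_mul_add_one_eq_zero_iff, F]
  set e := Complex.exp (Complex.I * π * t)
  by_cases h0 : y 0 0 = 0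
  · have h1 : y 0 1 ≠ 0 := fun h1 => hne (by rw [hcomb hx, h0, h1]; simp)
    refine mul_left_cancel₀ h1 ?_
    linear_combination (-y 0 1) * hdet + (e - c p q lam π 0) * hone + c p q lam π 1 * hzero
  · refine mul_left_cancel₀ h0 ?_
    linear_combination (-y 0 0) * hdet + (e - s p q lam π 1) * hzero + s p q lam π 0 * hone

theorem isSolution_Phi (t lam : ℂ) : IsSolution p q lam (Phi p q t lam) :=
  ((isSolution_c hp hq lam).const_smul _).add ((isSolution_s hp hq lam).const_smul _)

theorem Phi_zero (t lam : ℂ) : Phi p q t lam 0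
    = ![s p q lam π 0, Complex.exp (Complex.I * π * t) - c p q lam π 0] := by
  rw [Phi, c_zero hp hq, s_zero hp hq]
  ext i
  fin_cases i <;> simp

theorem isEigenfunction_Phi (hs : s p q lam π 0 ≠ 0) (hF : F p q lam = 2 * Complex.cos (t * π)) :
    IsEigenfunction p q t lam (Phi p q t lam) := by
  refine ⟨isSolution_Phi hp hq t lam, ?_, 0, left_mem_Icc.2 Real.pi_nonneg, fun h0 => ?_⟩
  · have hdet := c_mul_s_sub hp hq lam
    rw [← exp_sq_sub_mul_add_one_eq_zero_iff, F] at hF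
    rw [Phi_zero hp hq, Phi]
    ext i
    fin_cases i <;> simp only [Fin.zero_eta, Fin.mk_one, Pi.add_apply, Pi.smul_apply, smul_eq_mul,
      Matrix.cons_val_zero, Matrix.cons_val_one]
    · ring
    · linear_combination -hF - hdet
  · rw [Phi_zero hp hq] at h0
    exact hs (congrFun h0 0)

end Dirac

end Eigenvalues

section EigenfunctionAsymptotics

namespace Dirac

variable {p q : ℝ → ℂ} {σ t z : ℂ} {κ : ℝ}

theorem norm_two_mul_pi_mul_sin (hσ : σ = 1 ∨ σ = -1) (t : ℂ) :
    ‖2 * π * (σ * Complex.sin (t * π))‖ = 2 * π * ‖Complex.sin (t * π)‖ := by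
  rw [norm_mul, norm_mul, norm_mul, norm_eq_one_of_eq_one_or_neg_one hσ, one_mul,
    Complex.norm_ofNat, Complex.norm_real, Real.norm_of_nonneg Real.pi_nonneg]

theorem exists_eventually_norm_deriv_F_add_le_half (hp : BoundedVariationOn p (Icc 0 π))
    (hq : BoundedVariationOn q (Icc 0 π)) (hσ : σ = 1 ∨ σ = -1) (T : ℝ) (hκ : 0 < κ) :
    ∃ r, 0 < r ∧ ∀ᶠ n : ℤ in cofinite, ∀ t : ℂ, ‖t‖ ≤ T → κ ≤ ‖Complex.sin (t * π)‖ → ∀ z,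
      ‖z - freeEigenvalue σ n t‖ ≤ r → ‖deriv (F p q) z - -(2 * π * (σ * Complex.sin (t * π)))‖
        ≤ ‖-(2 * π * (σ * Complex.sin (t * π)))‖ / 2 := by
  obtain ⟨r, hr, hderiv⟩ := exists_eventually_norm_deriv_F_add_le hp hq hσ T
    (mul_pos Real.pi_pos hκ)
  refine ⟨r, hr, hderiv.mono fun n hn t ht hsin z hz => ?_⟩
  rw [sub_neg_eq_add, norm_neg, norm_two_mul_pi_mul_sin hσ, mul_assoc 2 π,
    mul_div_cancel_left₀ _ two_ne_zero]
  exact (hn t ht z hz).trans (by gcongr)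

theorem eventually_deriv_F_ne_zero (hp : BoundedVariationOn p (Icc 0 π))
    (hq : BoundedVariationOn q (Icc 0 π)) (hσ : σ = 1 ∨ σ = -1) (T C : ℝ) (hκ : 0 < κ) :
    ∀ᶠ n : ℤ in cofinite, ∀ t : ℂ, ‖t‖ ≤ T → κ ≤ ‖Complex.sin (t * π)‖ → ∀ z,
      ‖z - freeEigenvalue σ n t‖ ≤ C / |(n : ℝ)| → deriv (F p q) z ≠ 0 := by
  obtain ⟨r, hr, hderiv⟩ := exists_eventually_norm_deriv_F_add_le_half hp hq hσ T hκ
  filter_upwards [hderiv, eventually_cofinite_div_abs_int_le C hr] with n hn hC t ht hsin z hz h0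
  have hhalf := hn t ht hsin z (hz.trans hC)
  rw [h0, zero_sub, norm_neg, norm_neg, norm_two_mul_pi_mul_sin hσ] at hhalf
  have hpos : 0 < 2 * π * ‖Complex.sin (t * π)‖ := by
    have := hκ.trans_le hsin
    positivity
  exact hhalf.not_gt (half_lt_self hpos)

theorem exists_eventually_exists_F_eq (hp : BoundedVariationOn p (Icc 0 π))
    (hq : BoundedVariationOn q (Icc 0 π)) (hσ : σ = 1 ∨ σ = -1) (T : ℝ) (hκ : 0 < κ) :
    ∃ C : ℝ, ∀ᶠ n : ℤ in cofinite, ∀ t : ℂ, ‖t‖ ≤ T → κ ≤ ‖Complex.sin (t * π)‖ →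
      ∃ z, ‖z - freeEigenvalue σ n t‖ ≤ C / |(n : ℝ)| ∧ F p q z = 2 * Complex.cos (t * π) := by
  obtain ⟨r, hr, hderiv⟩ := exists_eventually_norm_deriv_F_add_le_half hp hq hσ T hκ
  obtain ⟨K, hF⟩ := exists_eventually_norm_F_sub_le hp hq
    (norm_eq_one_of_eq_one_or_neg_one hσ) T
  refine ⟨|K| / (π * κ), ?_⟩
  filter_upwards [hderiv, hF, eventually_cofinite_div_abs_int_le (|K| / (π * κ)) hr]
    with n hn hFn hC t ht hsin
  have hFn' := hFn t ht (freeEigenvalue σ n t) (by rw [sub_self, norm_zero]; exact zero_le_one)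
  rw [cos_freeEigenvalue_mul_pi hσ, norm_sub_rev] at hFn'
  have hpos := hκ.trans_le hsin
  have hnorm : ‖-(2 * π * (σ * Complex.sin (t * π)))‖ = 2 * (π * ‖Complex.sin (t * π)‖) := by
    rw [norm_neg, norm_two_mul_pi_mul_sin hσ, mul_assoc]
  obtain ⟨z, hz, hFz⟩ := exists_mem_closedBall_eq_of_norm_deriv_sub_le
    (norm_pos_iff.1 (by rw [hnorm]; positivity)) (by positivity)
    (fun z _ => differentiable_F hp hq z)
    (fun z hz => hn t ht hsin z ((mem_closedBall_iff_norm.1 hz).trans hC)) <| calc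
      _ ≤ |K| / |(n : ℝ)| := hFn'.trans (by gcongr; exact le_abs_self K)
      _ = π * κ * (|K| / (π * κ) / |(n : ℝ)|) := by field_simp
      _ ≤ ‖-(2 * π * (σ * Complex.sin (t * π)))‖ / 2 * (|K| / (π * κ) / |(n : ℝ)|) := by
        rw [hnorm, mul_div_cancel_left₀ _ two_ne_zero]
        gcongr
  exact ⟨z, mem_closedBall_iff_norm.1 hz, hFz⟩

theorem eventually_half_le_norm_s_pi (hp : BoundedVariationOn p (Icc 0 π))
    (hq : BoundedVariationOn q (Icc 0 π)) (hσ : σ = 1 ∨ σ = -1) (T C : ℝ) (hκ : 0 < κ) :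
    ∀ᶠ n : ℤ in cofinite, ∀ t : ℂ, ‖t‖ ≤ T → κ ≤ ‖Complex.sin (t * π)‖ → ∀ z,
      ‖z - freeEigenvalue σ n t‖ ≤ C / |(n : ℝ)| → κ / 2 ≤ ‖s p q z π 0‖ := by
  obtain ⟨K, -, hK⟩ := exists_eventually_norm_monodromy_sub_le hp hq hσ T C
  filter_upwards [hK, eventually_cofinite_div_abs_int_le K (half_pos hκ)]
    with n hn hKn t ht hsin z hz
  have hle := norm_sub_norm_le (σ * Complex.sin (t * π)) (s p q z π 0 + σ * Complex.sin (t * π))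
  rw [sub_add_cancel_right, norm_neg, norm_mul, norm_eq_one_of_eq_one_or_neg_one hσ,
    one_mul] at hle
  linarith [(hn t ht z hz).2]

theorem norm_exp_sub_add_mul_le {δ : ℝ} (hσ : σ = 1 ∨ σ = -1) (t : ℂ) {c₁ s₁ : ℂ}
    (hc : ‖c₁ - Complex.cos (t * π)‖ ≤ δ) (hs : ‖s₁ + σ * Complex.sin (t * π)‖ ≤ δ) :
    ‖Complex.exp (Complex.I * π * t) - c₁ + σ * Complex.I * s₁‖ ≤ 2 * δ := by
  have hσ2 : σ * σ = 1 := mul_self_eq_one_iff.2 hσ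
  have hsplit : Complex.exp (Complex.I * π * t) - c₁ + σ * Complex.I * s₁
      = -(c₁ - Complex.cos (t * π)) + σ * Complex.I * (s₁ + σ * Complex.sin (t * π)) := by
    rw [mul_assoc, mul_comm (π : ℂ), exp_mul_eq_cos_add_mul_sin Complex.I_mul_I]
    linear_combination -Complex.I * Complex.sin (t * π) * hσ2
  rw [hsplit, two_mul]
  refine norm_add_le_of_le ((norm_neg _).trans_le hc) ?_
  rwa [norm_mul, norm_mul, Complex.norm_I, norm_eq_one_of_eq_one_or_neg_one hσ, one_mul, one_mul]

theorem exists_eventually_norm_inv_smul_Phi_zero_sub_le (hp : BoundedVariationOn p (Icc 0 π))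
    (hq : BoundedVariationOn q (Icc 0 π)) (hσ : σ = 1 ∨ σ = -1) (T C : ℝ) (hκ : 0 < κ) :
    ∃ K, 0 ≤ K ∧ ∀ᶠ n : ℤ in cofinite, ∀ t : ℂ, ‖t‖ ≤ T → κ ≤ ‖Complex.sin (t * π)‖ → ∀ z,
      ‖z - freeEigenvalue σ n t‖ ≤ C / |(n : ℝ)| →
        ‖(s p q z π 0)⁻¹ • Phi p q t z 0 - ![1, -(σ * Complex.I)]‖ ≤ K / |(n : ℝ)| := by
  obtain ⟨K, hK, hmonodromy⟩ := exists_eventually_norm_monodromy_sub_le hp hq hσ T C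
  refine ⟨(κ / 2)⁻¹ * (2 * K), by positivity, ?_⟩
  filter_upwards [hmonodromy, eventually_half_le_norm_s_pi hp hq hσ T C hκ]
    with n hn hsn t ht hsin z hz
  have hs := hsn t ht hsin z hz
  have hs0 : s p q z π 0 ≠ 0 := norm_pos_iff.1 ((half_pos hκ).trans_le hs)
  have hslope : (s p q z π 0)⁻¹ • Phi p q t z 0 - ![1, -(σ * Complex.I)]
      = ![0, (s p q z π 0)⁻¹ * (Complex.exp (Complex.I * π * t) - c p q z π 0
          + σ * Complex.I * s p q z π 0)] := by
    rw [Phi_zero hp hq]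
    ext i
    fin_cases i <;> simp only [Fin.zero_eta, Fin.mk_one, Pi.sub_apply, Pi.smul_apply, smul_eq_mul,
      Matrix.cons_val_zero, Matrix.cons_val_one] <;> field_simp <;> ring
  rw [hslope, mul_div_assoc, mul_div_assoc]
  refine (pi_norm_le_iff_of_nonneg (by positivity)).2 (Fin.forall_fin_two.2 ⟨?_, ?_⟩)
  · rw [Matrix.cons_val_zero, norm_zero]
    positivity
  · rw [Matrix.cons_val_one, Matrix.cons_val_zero, norm_mul, norm_inv]
    gcongr
    exact norm_exp_sub_add_mul_le hσ t (hn t ht z hz).1 (hn t ht z hz).2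

theorem norm_sub_exp_smul_le {j w : ℂ} {v v₀ : Fin 2 → ℂ} {δ η : ℝ} (hj : j * j = -1)
    (hδ : 0 ≤ δ) (hv : ‖v - rotationMatrix w *ᵥ v₀‖ ≤ δ * ‖v₀‖) (hv₀ : ‖v₀ - ![1, -j]‖ ≤ η) :
    ‖v - Complex.exp (j * w) • ![1, -j]‖ ≤ δ * (η + 1) + 2 * Real.exp |w.im| * η := by
  have hone : ‖(![1, -j] : Fin 2 → ℂ)‖ = 1 := by
    simp [Pi.norm_def, Fin.univ_succ, norm_eq_one_of_mul_self_eq_neg_one hj]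
  have hnorm : ‖v₀‖ ≤ η + 1 := by
    rw [← sub_add_cancel v₀ ![1, -j]]
    exact norm_add_le_of_le hv₀ hone.le
  rw [← rotationMatrix_mulVec_eigenvector hj, ← sub_add_sub_cancel _ (rotationMatrix w *ᵥ v₀),
    ← Matrix.mulVec_sub]
  refine norm_add_le_of_le (hv.trans (by gcongr)) ?_
  exact (norm_rotationMatrix_mulVec_le w _).trans (by gcongr)

theorem exists_eventually_norm_inv_smul_Phi_sub_le (hp : BoundedVariationOn p (Icc 0 π))
    (hq : BoundedVariationOn q (Icc 0 π)) (hσ : σ = 1 ∨ σ = -1) (T C : ℝ) (hκ : 0 < κ) :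
    ∃ K : ℝ, ∀ᶠ n : ℤ in cofinite, ∀ t : ℂ, ‖t‖ ≤ T → κ ≤ ‖Complex.sin (t * π)‖ → ∀ z,
      ‖z - freeEigenvalue σ n t‖ ≤ C / |(n : ℝ)| → ∀ x ∈ Icc 0 π,
        ‖(s p q z π 0)⁻¹ • Phi p q t z x
          - Complex.exp (σ * Complex.I * (freeEigenvalue σ n t * x)) • ![1, -(σ * Complex.I)]‖
        ≤ K / |(n : ℝ)| := by
  have hσ1 := norm_eq_one_of_eq_one_or_neg_one hσ
  obtain ⟨K, hK, hrot⟩ :=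
    exists_eventually_norm_sub_rotationMatrix_freeEigenvalue_mulVec_le hp hq hσ1 T C
  obtain ⟨M, hM, hzero⟩ := exists_eventually_norm_inv_smul_Phi_zero_sub_le hp hq hσ T C hκ
  refine ⟨K * (1 + 1) + 2 * Real.exp ((T + 1) * π) * M, ?_⟩
  filter_upwards [hrot, hzero, eventually_cofinite_div_abs_int_le M one_pos]
    with n hn hn₀ hMn t ht hsin z hz x hx
  have him := abs_im_mul_ofReal_le (abs_im_le_of_norm_sub_freeEigenvalue_le (n := n) hσ1 ht
    (by rw [sub_self, norm_zero]; exact zero_le_one)) hx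
  have hj : σ * Complex.I * (σ * Complex.I) = -1 := by
    rw [mul_mul_mul_comm, mul_self_eq_one_iff.2 hσ, Complex.I_mul_I, one_mul]
  calc _ ≤ K / |(n : ℝ)| * (M / |(n : ℝ)| + 1)
        + 2 * Real.exp |(freeEigenvalue σ n t * x).im| * (M / |(n : ℝ)|) :=
      norm_sub_exp_smul_le hj (by positivity)
        (hn t ht z hz _ ((isSolution_Phi hp hq t z).const_smul _) x hx) (hn₀ t ht hsin z hz)
    _ ≤ K / |(n : ℝ)| * (1 + 1) + 2 * Real.exp ((T + 1) * π) * (M / |(n : ℝ)|) := by gcongr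
    _ = (K * (1 + 1) + 2 * Real.exp ((T + 1) * π) * M) / |(n : ℝ)| := by ring

end Dirac

end EigenfunctionAsymptotics

section EigenvalueSequences

namespace Dirac

variable {p q : ℝ → ℂ} {S : Set ℂ} {σ : ℂ} {lam : ℤ → ℂ → ℂ}

/-- The analogue of `IsEigenvalueSequence` for an arbitrary set `S` of quasimomenta `t` in place
of `D h`. -/
def IsEigenvalueSequenceOn (p q : ℝ → ℂ) (S : Set ℂ) (σ : ℂ) (lam : ℤ → ℂ → ℂ) : Prop :=
  ∃ N : ℕ, ∃ C : ℝ, ∀ n : ℤ, (N : ℤ) < |n| → ∀ t ∈ S,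
    IsEigenvalue p q t (lam n t) ∧ ‖lam n t - (2 * n + σ * t)‖ ≤ C / |(n : ℝ)|

theorem isEigenvalueSequenceOn_iff : IsEigenvalueSequenceOn p q S σ lam ↔
    ∃ C : ℝ, ∀ᶠ n : ℤ in cofinite, ∀ t ∈ S,
      IsEigenvalue p q t (lam n t) ∧ ‖lam n t - freeEigenvalue σ n t‖ ≤ C / |(n : ℝ)| := by
  simp only [eventually_cofinite_int_iff]
  exact exists_comm

theorem sin_mul_pi_ne_zero {t : ℂ} (ht : ∀ k : ℤ, t ≠ k) : Complex.sin (t * π) ≠ 0 := by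
  rw [Complex.sin_ne_zero_iff]
  intro k hk
  exact ht k (mul_right_cancel₀ (Complex.ofReal_ne_zero.2 Real.pi_ne_zero) hk)

theorem exists_forall_le_norm_sin_mul_pi (hS : IsCompact S) (hSint : ∀ t ∈ S, ∀ k : ℤ, t ≠ k) :
    ∃ κ, 0 < κ ∧ ∀ t ∈ S, κ ≤ ‖Complex.sin (t * π)‖ :=
  hS.exists_forall_le' (by fun_prop) fun t ht => norm_pos_iff.2 (sin_mul_pi_ne_zero (hSint t ht))

variable (hp : BoundedVariationOn p (Icc 0 π)) (hq : BoundedVariationOn q (Icc 0 π))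
  (hS : IsCompact S) (hSint : ∀ t ∈ S, ∀ k : ℤ, t ≠ k) (hσ : σ = 1 ∨ σ = -1)
include hp hq hS hSint hσ

theorem exists_isEigenvalueSequenceOn : ∃ lam, IsEigenvalueSequenceOn p q S σ lam := by
  obtain ⟨T, hT⟩ := hS.isBounded.exists_norm_le
  obtain ⟨κ, hκ, hsin⟩ := exists_forall_le_norm_sin_mul_pi hS hSint
  obtain ⟨C, hF⟩ := exists_eventually_exists_F_eq hp hq hσ T hκ
  refine ⟨fun n t => Classical.epsilon fun z =>
    ‖z - freeEigenvalue σ n t‖ ≤ C / |(n : ℝ)| ∧ F p q z = 2 * Complex.cos (t * π),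
    isEigenvalueSequenceOn_iff.2 ⟨C, ?_⟩⟩
  filter_upwards [hF, eventually_half_le_norm_s_pi hp hq hσ T C hκ] with n hn hs t ht
  obtain ⟨hdist, hroot⟩ := Classical.epsilon_spec (hn t (hT t ht) (hsin t ht))
  have hs0 := (half_pos hκ).trans_le (hs t (hT t ht) (hsin t ht) _ hdist)
  exact ⟨⟨_, isEigenfunction_Phi hp hq (norm_pos_iff.1 hs0) hroot⟩, hdist⟩

theorem IsEigenvalueSequenceOn.eventually_deriv_F_ne_zero
    (hlam : IsEigenvalueSequenceOn p q S σ lam) :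
    ∀ᶠ n : ℤ in cofinite, ∀ t ∈ S, deriv (F p q) (lam n t) ≠ 0 := by
  obtain ⟨T, hT⟩ := hS.isBounded.exists_norm_le
  obtain ⟨κ, hκ, hsin⟩ := exists_forall_le_norm_sin_mul_pi hS hSint
  obtain ⟨C, hC⟩ := isEigenvalueSequenceOn_iff.1 hlam
  filter_upwards [hC, Dirac.eventually_deriv_F_ne_zero hp hq hσ T C hκ] with n hn hne t ht
  exact hne t (hT t ht) (hsin t ht) _ (hn t ht).2

theorem IsEigenvalueSequenceOn.eventually_s_pi_ne_zero
    (hlam : IsEigenvalueSequenceOn p q S σ lam) :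
    ∀ᶠ n : ℤ in cofinite, ∀ t ∈ S, s p q (lam n t) π 0 ≠ 0 := by
  obtain ⟨T, hT⟩ := hS.isBounded.exists_norm_le
  obtain ⟨κ, hκ, hsin⟩ := exists_forall_le_norm_sin_mul_pi hS hSint
  obtain ⟨C, hC⟩ := isEigenvalueSequenceOn_iff.1 hlam
  filter_upwards [hC, eventually_half_le_norm_s_pi hp hq hσ T C hκ] with n hn hs t ht
  exact norm_pos_iff.1 ((half_pos hκ).trans_le (hs t (hT t ht) (hsin t ht) _ (hn t ht).2))

theorem IsEigenvalueSequenceOn.eventually_isEigenfunction_Phi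
    (hlam : IsEigenvalueSequenceOn p q S σ lam) :
    ∀ᶠ n : ℤ in cofinite, ∀ t ∈ S, IsEigenfunction p q t (lam n t) (Phi p q t (lam n t)) := by
  obtain ⟨C, hC⟩ := isEigenvalueSequenceOn_iff.1 hlam
  filter_upwards [hC, hlam.eventually_s_pi_ne_zero hp hq hS hSint hσ] with n hn hs t ht
  exact isEigenfunction_Phi hp hq (hs t ht) ((hn t ht).1.F_eq hp hq)

theorem IsEigenvalueSequenceOn.exists_eventually_norm_inv_smul_Phi_sub_le
    (hlam : IsEigenvalueSequenceOn p q S σ lam) :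
    ∃ K : ℝ, ∀ᶠ n : ℤ in cofinite, ∀ t ∈ S, ∀ x ∈ Icc 0 π,
      ‖(s p q (lam n t) π 0)⁻¹ • Phi p q t (lam n t) x
          - Complex.exp (Complex.I * (σ * 2 * n + t) * x) • ![1, -(σ * Complex.I)]‖
        ≤ K / |(n : ℝ)| := by
  obtain ⟨T, hT⟩ := hS.isBounded.exists_norm_le
  obtain ⟨κ, hκ, hsin⟩ := exists_forall_le_norm_sin_mul_pi hS hSint
  obtain ⟨C, hC⟩ := isEigenvalueSequenceOn_iff.1 hlam
  obtain ⟨K, hK⟩ := Dirac.exists_eventually_norm_inv_smul_Phi_sub_le hp hq hσ T C hκ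
  refine ⟨K, ?_⟩
  filter_upwards [hC, hK] with n hn hPhi t ht x hx
  have hphase : Complex.I * (σ * 2 * n + t) * x
      = σ * Complex.I * (freeEigenvalue σ n t * x) := by
    rw [freeEigenvalue]
    linear_combination -Complex.I * t * x * mul_self_eq_one_iff.2 hσ
  rw [hphase]
  exact hPhi t (hT t ht) (hsin t ht) _ (hn t ht).2 x hx

end Dirac

end EigenvalueSequences

section Domain

namespace Dirac

variable {h : ℝ} {t : ℂ}

theorem isCompact_D (h : ℝ) : IsCompact (D h) := by
  refine IsCompact.diff ?_ (Metric.isOpen_ball.union Metric.isOpen_ball)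
  have hrect : {t : ℂ | |t.im| ≤ 2 * h ∧ -h ≤ t.re ∧ t.re ≤ 2 - h}
      = Icc (-h) (2 - h) ×ℂ Icc (-(2 * h)) (2 * h) := by
    ext t
    simp only [mem_ofPred_eq, Complex.mem_reProdIm, mem_Icc, abs_le, and_comm]
  rw [hrect]
  exact isCompact_Icc.reProdIm isCompact_Icc

theorem ne_intCast_of_mem_D (h_pos : 0 < h) (h_lt : h < 1) (ht : t ∈ D h) (k : ℤ) : t ≠ k := by
  rintro rfl
  obtain ⟨⟨-, hlower, hupper⟩, hballs⟩ := ht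
  rw [Complex.intCast_re] at hlower hupper
  have hk : -1 < k ∧ k < 2 := by
    constructor <;> rify <;> linarith
  obtain rfl | rfl : k = 0 ∨ k = 1 := by lia
  · exact hballs (Or.inl (by simpa using h_pos))
  · exact hballs (Or.inr (by simpa using h_pos))

end Dirac

end Domain

theorem theorem2_general (p q : ℝ → ℂ) (hp : BoundedVariationOn p (Icc 0 π))
    (hq : BoundedVariationOn q (Icc 0 π)) (S : Set ℂ) (hS : IsCompact S)
    (hSint : ∀ t ∈ S, ∀ k : ℤ, t ≠ k) :
    (∃ lam₁ lam₂ : ℤ → ℂ → ℂ, Dirac.IsEigenvalueSequenceOn p q S 1 lam₁ ∧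
      Dirac.IsEigenvalueSequenceOn p q S (-1) lam₂) ∧
    ∀ lam₁ lam₂ : ℤ → ℂ → ℂ, Dirac.IsEigenvalueSequenceOn p q S 1 lam₁ →
      Dirac.IsEigenvalueSequenceOn p q S (-1) lam₂ →
      ∃ N : ℕ, ∃ C : ℝ, ∀ n : ℤ, (N : ℤ) < |n| → ∀ t ∈ S,
        (deriv (Dirac.F p q) (lam₁ n t) ≠ 0 ∧ Dirac.s p q (lam₁ n t) π 0 ≠ 0 ∧
          Dirac.IsEigenfunction p q t (lam₁ n t) (Dirac.Phi p q t (lam₁ n t)) ∧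
          ∀ x ∈ Icc 0 π,
            ‖(Dirac.s p q (lam₁ n t) π 0)⁻¹ • Dirac.Phi p q t (lam₁ n t) x
              - Complex.exp (Complex.I * (2 * n + t) * x) • ![1, -Complex.I]‖ ≤ C / |(n : ℝ)|) ∧
        (deriv (Dirac.F p q) (lam₂ n t) ≠ 0 ∧ Dirac.s p q (lam₂ n t) π 0 ≠ 0 ∧
          Dirac.IsEigenfunction p q t (lam₂ n t) (Dirac.Phi p q t (lam₂ n t)) ∧
          ∀ x ∈ Icc 0 π,
            ‖(Dirac.s p q (lam₂ n t) π 0)⁻¹ • Dirac.Phi p q t (lam₂ n t) x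
              - Complex.exp (Complex.I * (-2 * n + t) * x) • ![1, Complex.I]‖
                ≤ C / |(n : ℝ)|) := by
  have hσ₁ : (1 : ℂ) = 1 ∨ (1 : ℂ) = -1 := Or.inl rfl
  have hσ₂ : (-1 : ℂ) = 1 ∨ (-1 : ℂ) = -1 := Or.inr rfl
  obtain ⟨_, hex₁⟩ := Dirac.exists_isEigenvalueSequenceOn hp hq hS hSint hσ₁
  obtain ⟨_, hex₂⟩ := Dirac.exists_isEigenvalueSequenceOn hp hq hS hSint hσ₂
  refine ⟨⟨_, _, hex₁, hex₂⟩, fun lam₁ lam₂ hlam₁ hlam₂ => ?_⟩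
  obtain ⟨K₁, hK₁⟩ := hlam₁.exists_eventually_norm_inv_smul_Phi_sub_le hp hq hS hSint hσ₁
  obtain ⟨K₂, hK₂⟩ := hlam₂.exists_eventually_norm_inv_smul_Phi_sub_le hp hq hS hSint hσ₂
  simp only [one_mul, neg_mul, neg_neg] at hK₁ hK₂ ⊢
  refine exists_comm.1 ⟨max K₁ K₂, eventually_cofinite_int_iff.1 ?_⟩
  filter_upwards [hK₁, hlam₁.eventually_deriv_F_ne_zero hp hq hS hSint hσ₁,
    hlam₁.eventually_s_pi_ne_zero hp hq hS hSint hσ₁,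
    hlam₁.eventually_isEigenfunction_Phi hp hq hS hSint hσ₁,
    hK₂, hlam₂.eventually_deriv_F_ne_zero hp hq hS hSint hσ₂,
    hlam₂.eventually_s_pi_ne_zero hp hq hS hSint hσ₂,
    hlam₂.eventually_isEigenfunction_Phi hp hq hS hSint hσ₂]
    with n hΦ₁ hF₁ hs₁ hE₁ hΦ₂ hF₂ hs₂ hE₂ t ht
  exact ⟨⟨hF₁ t ht, hs₁ t ht, hE₁ t ht, fun x hx =>
      (hΦ₁ t ht x hx).trans (by gcongr; exact le_max_left _ _)⟩,
    hF₂ t ht, hs₂ t ht, hE₂ t ht, fun x hx =>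
      (hΦ₂ t ht x hx).trans (by gcongr; exact le_max_right _ _)⟩

end

theorem theorem2 (p q : ℝ → ℂ)
    (hp : BoundedVariationOn p (Set.Icc 0 Real.pi)) (hq : BoundedVariationOn q (Set.Icc 0 Real.pi))
    (h : ℝ) (h_pos : 0 < h) (h_lt : h < 1 / 10) :
    (∃ lam₁ lam₂ : ℤ → ℂ → ℂ, Dirac.IsEigenvalueSequence p q h 1 lam₁ ∧
      Dirac.IsEigenvalueSequence p q h (-1) lam₂) ∧
    ∀ lam₁ lam₂ : ℤ → ℂ → ℂ, Dirac.IsEigenvalueSequence p q h 1 lam₁ →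
      Dirac.IsEigenvalueSequence p q h (-1) lam₂ →
      ∃ N : ℕ, ∃ C : ℝ, ∀ n : ℤ, (N : ℤ) < |n| → ∀ t ∈ Dirac.D h,
        (deriv (Dirac.F p q) (lam₁ n t) ≠ 0 ∧ Dirac.s p q (lam₁ n t) Real.pi 0 ≠ 0 ∧
          Dirac.IsEigenfunction p q t (lam₁ n t) (Dirac.Phi p q t (lam₁ n t)) ∧
          ∀ x ∈ Set.Icc 0 Real.pi,
            ‖(Dirac.s p q (lam₁ n t) Real.pi 0)⁻¹ • Dirac.Phi p q t (lam₁ n t) x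
              - Complex.exp (Complex.I * (2 * n + t) * x) • ![1, -Complex.I]‖ ≤ C / |(n : ℝ)|) ∧
        (deriv (Dirac.F p q) (lam₂ n t) ≠ 0 ∧ Dirac.s p q (lam₂ n t) Real.pi 0 ≠ 0 ∧
          Dirac.IsEigenfunction p q t (lam₂ n t) (Dirac.Phi p q t (lam₂ n t)) ∧
          ∀ x ∈ Set.Icc 0 Real.pi,
            ‖(Dirac.s p q (lam₂ n t) Real.pi 0)⁻¹ • Dirac.Phi p q t (lam₂ n t) x
              - Complex.exp (Complex.I * (-2 * n + t) * x) • ![1, Complex.I]‖ ≤ C / |(n : ℝ)|) :=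
  theorem2_general p q hp hq (Dirac.D h) (Dirac.isCompact_D h) fun _ ht =>
    Dirac.ne_intCast_of_mem_D h_pos (by linarith) ht
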